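/- Let $\mathbb{D}$ be the open unit disc, $\sigma$ area measure on $\mathbb{D}$ normalized by $\sigma(\mathbb{D})=1$, let $1<p<\infty$ and $1/p+1/q=1$. For $1<r<\infty$ let $A^r$ be the Bergman space of analytic functions $f$ on $\mathbb{D}$ with $\|f\|_{A^r}=\left(\int_{\mathbb{D}}|f|^r\,d\sigma\right)^{1/r}<\infty$. For $f\in L^1(\mathbb{D},\sigma)$ let $$(\mathcal{P}f)(z)=\int_{\mathbb{D}}\frac{f(\zeta)}{(1-\overline{\zeta}z)^2}\,d\sigma(\zeta),\qquad z\in\mathbb{D},$$ be the Bergman projection, and let $\operatorname{sgn} w=w/|w|$ for $w\in\mathbb{C}\setminus\{0\}$, $\operatorname{sgn}0=0$. A kernel of a bounded linear functional $\phi\in(A^p)^*$ is a function $k\in A^q$ with $\phi(f)=\int_{\mathbb{D}}f\,\overline{k}\,d\sigma$ for all $f\in A^p$. Let $\phi_1,\dots,\phi_N\in(A^p)^*$ be linearly independent. Then each $\phi_j$ has exactly one kernel $k_j\in A^q$, and a function $F\in A^p$ satisfies $$\|F\|_{A^p}=\inf\{\|f\|_{A^p}: f\in A^p,\ \phi_1(f)=\phi_1(F),\dots,\phi_N(f)=\phi_N(F)\}$$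 if and only if $\mathcal{P}(|F|^{p-1}\operatorname{sgn}F)$ is a linear combination, with complex coefficients, of $k_1,\dots,k_N$. -/

import Mathlib

open MeasureTheory
open scoped ENNReal ComplexConjugate

noncomputable section

/-- The open unit disc in the complex plane. -/
abbrev Disc : Type := Metric.ball (0 : ℂ) 1

/-- Normalized area measure on the unit disc. -/
def discMeasure : Measure Disc :=
  (ENNReal.ofReal Real.pi)⁻¹ • Measure.comap (Subtype.val : Disc → ℂ) volume

instance : IsProbabilityMeasure discMeasure := by
  constructor
  have h : Measure.comap (Subtype.val : Disc → ℂ) volume Set.univ = ENNReal.ofReal Real.pi := by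
    rw [comap_subtype_coe_apply measurableSet_ball]
    rw [Set.image_univ, Subtype.range_coe, Complex.volume_ball]
    rw [ENNReal.ofReal_one, one_pow, one_mul, ENNReal.ofReal,
      Real.toNNReal_of_nonneg Real.pi_pos.le]
    rfl
  rw [discMeasure, Measure.smul_apply, h, smul_eq_mul]
  exact ENNReal.inv_mul_cancel (by simp [Real.pi_pos]) ENNReal.ofReal_ne_top

instance : Measure.IsOpenPosMeasure discMeasure := by
  constructor
  intro U hU hne h0
  rw [discMeasure, Measure.smul_apply, smul_eq_mul,
    comap_subtype_coe_apply measurableSet_ball] at h0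
  have h1 : IsOpen ((Subtype.val : Disc → ℂ) '' U) :=
    Metric.isOpen_ball.isOpenMap_subtype_val U hU
  have h2 := h1.measure_ne_zero volume (hne.image _)
  rcases mul_eq_zero.1 h0 with h | h
  · exact ENNReal.inv_ne_zero.2 ENNReal.ofReal_ne_top h
  · exact h2 h

/-- A function on the unit disc is analytic if it is the restriction to the disc of a function on
`ℂ` that is complex differentiable at each point of the disc. -/
def DiscAnalytic (f : Disc → ℂ) : Prop :=
  ∃ g : ℂ → ℂ, DifferentiableOn ℂ g (Metric.ball 0 1) ∧ ∀ z : Disc, f z = g z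

theorem DiscAnalytic.continuous {f : Disc → ℂ} (hf : DiscAnalytic f) : Continuous f := by
  obtain ⟨g, hg, hfg⟩ := hf
  have : f = (Metric.ball (0 : ℂ) 1).domRestrict g := funext hfg
  rw [this]
  exact hg.continuousOn.domRestrict

/-- The analytic functions on the disc with `∫ |f| ^ p dσ < ∞`, as a space of functions. -/
def bergmanSubmodule (p : ℝ) : Submodule ℂ (Disc → ℂ) where
  carrier := {f | DiscAnalytic f ∧ MemLp f (ENNReal.ofReal p) discMeasure}
  zero_mem' := ⟨⟨0, differentiableOn_const 0, fun _ => rfl⟩, MemLp.zero⟩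
  add_mem' := by
    rintro f₁ f₂ ⟨⟨g₁, hg₁, h₁⟩, hm₁⟩ ⟨⟨g₂, hg₂, h₂⟩, hm₂⟩
    exact ⟨⟨g₁ + g₂, hg₁.add hg₂, fun z => by simp [h₁ z, h₂ z]⟩, hm₁.add hm₂⟩
  smul_mem' := by
    rintro c f ⟨⟨g, hg, h⟩, hm⟩
    exact ⟨⟨c • g, hg.const_smul c, fun z => by simp [h z]⟩, hm.const_smul c⟩

/-- The Bergman space `A ^ p`. It is a type of its own, so that it carries the topology of the
`A ^ p` norm below and not that of pointwise convergence. -/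
def BergmanSpace (p : ℝ) : Type := bergmanSubmodule p

namespace BergmanSpace

variable {p : ℝ}

instance : AddCommGroup (BergmanSpace p) := inferInstanceAs (AddCommGroup (bergmanSubmodule p))

instance : Module ℂ (BergmanSpace p) := inferInstanceAs (Module ℂ (bergmanSubmodule p))

instance : CoeFun (BergmanSpace p) (fun _ => Disc → ℂ) := ⟨fun f => f.1⟩

theorem memLp (f : BergmanSpace p) : MemLp (f : Disc → ℂ) (ENNReal.ofReal p) discMeasure := f.2.2

/-- The inclusion of `A ^ p` in `L ^ p`. -/
def toLp (p : ℝ) : BergmanSpace p →ₗ[ℂ] Lp ℂ (ENNReal.ofReal p) discMeasure where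
  toFun f := f.memLp.toLp _
  map_add' f g := MemLp.toLp_add f.memLp g.memLp
  map_smul' c f := MemLp.toLp_const_smul c f.memLp

theorem toLp_injective (p : ℝ) : Function.Injective (toLp p) := by
  intro f g h
  have h1 : (f : Disc → ℂ) =ᵐ[discMeasure] g := (MemLp.toLp_eq_toLp_iff f.memLp g.memLp).1 h
  exact Subtype.ext (Measure.eq_of_ae_eq h1 f.2.1.continuous g.2.1.continuous)

instance [hp : Fact (1 < p)] : Fact (1 ≤ ENNReal.ofReal p) :=
  ⟨ENNReal.one_le_ofReal.2 hp.out.le⟩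

/-- The norm of `A ^ p` is the `L ^ p` norm with respect to normalized area measure. -/
instance [Fact (1 < p)] : NormedAddCommGroup (BergmanSpace p) :=
  NormedAddCommGroup.induced _ _ (toLp p) (toLp_injective p)

instance [Fact (1 < p)] : NormedSpace ℂ (BergmanSpace p) :=
  NormedSpace.induced ℂ (BergmanSpace p) (Lp ℂ (ENNReal.ofReal p) discMeasure) (toLp p)

theorem norm_eq [hp : Fact (1 < p)] (f : BergmanSpace p) :
    ‖f‖ = (∫ z, ‖f z‖ ^ p ∂discMeasure) ^ (1 / p) := by
  have h0 : 0 < p := one_pos.trans hp.out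
  have h1 : ‖f‖ = (eLpNorm (f : Disc → ℂ) (ENNReal.ofReal p) discMeasure).toReal :=
    Lp.norm_toLp _ f.memLp
  rw [h1, f.memLp.eLpNorm_eq_integral_rpow_norm (by simpa using h0) ENNReal.ofReal_ne_top,
    ENNReal.toReal_ofReal (by positivity), ENNReal.toReal_ofReal h0.le, one_div]

end BergmanSpace

/-- `k ∈ A ^ q` is a kernel of the bounded linear functional `φ` on `A ^ p` if
`φ(f) = ∫ f(z) conj(k(z)) dσ(z)` for all `f ∈ A ^ p`. -/
def IsKernel {p q : ℝ} [Fact (1 < p)] (φ : StrongDual ℂ (BergmanSpace p))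
    (k : BergmanSpace q) : Prop :=
  ∀ f : BergmanSpace p, φ f = ∫ z, f z * conj (k z) ∂discMeasure

/-- The Bergman projection `(P f)(z) = ∫ f(ζ) / (1 - conj(ζ) z) ^ 2 dσ(ζ)`. -/
def bergmanProjection (f : Disc → ℂ) (z : Disc) : ℂ :=
  ∫ ζ : Disc, f ζ / (1 - conj (ζ : ℂ) * (z : ℂ)) ^ 2 ∂discMeasure

/-- The complex sign `w / |w|`, with value `0` at `0`. -/
def complexSgn (w : ℂ) : ℂ := w / (‖w‖ : ℂ)

end

/-! Let `M` be the common null space of the functionals. The competitors for `F` form the coset `F +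
M`, and `F` has least norm there exactly when `G = |F|^(p-1) sgn F` annihilates `M` under the
pairing `∫ h conj(G)` (`forall_norm_le_norm_add_iff`). One direction is Hölder's inequality with its
equality case; the other is a variational argument along `F + t h`, `t → 0+`. By linear algebra, a
functional vanishes on `M` iff it lies in the span of the `φ j`. It remains to translate functionals
into kernels: the projection `P` is self-adjoint and fixes `A^p`, so the functional given by `G` has
kernel `P G` (`isKernel_pairingFunctional`), and a kernel is recovered from its functional by `k(w)
= conj(φ(K_w))`, with `K_w` the Bergman kernel function (`IsKernel.apply_eq`).

Existence of kernels is the duality of `A^p` and `A^q`, obtained constructively. The only candidate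
is `k(z) = ∑ (n+1) conj(φ(z^n)) z^n`. For `g` supported in a smaller disc, `φ(P g) = ∫ g conj(k)`
term by term; testing with truncations of `|k|^(q-1) sgn k` bounds `k` in `L^q`, and exhausting the
disc gives the identity for all `f = P f`.

Both halves rest on the boundedness of `P` on `L^p`, which follows from Schur's test with a power of
`1 - |z|^2` as weight and the Forelli–Rudin estimate. -/

/-! ### Normalized area measure in polar coordinates -/

theorem lintegral_discMeasure (f : ℂ → ℝ≥0∞) :
    ∫⁻ z : Disc, f z ∂discMeasure =
      (ENNReal.ofReal Real.pi)⁻¹ * ∫⁻ z in Metric.ball (0 : ℂ) 1, f z := by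
  rw [discMeasure, lintegral_smul_measure, smul_eq_mul,
    lintegral_subtype_comap Metric.isOpen_ball.measurableSet f]

theorem integral_discMeasure (f : ℂ → ℂ) :
    ∫ z : Disc, f z ∂discMeasure =
      (Real.pi⁻¹ : ℝ) • ∫ z in Metric.ball (0 : ℂ) 1, f z := by
  rw [discMeasure, integral_smul_measure,
    integral_subtype_comap Metric.isOpen_ball.measurableSet f, ENNReal.toReal_inv,
    ENNReal.toReal_ofReal Real.pi_pos.le]

theorem complex_polarCoord_symm_eq_circleMap (x : ℝ × ℝ) :
    Complex.polarCoord.symm x = circleMap 0 x.1 x.2 := by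
  simp [circleMap, Complex.exp_mul_I]

theorem indicator_ball_circleMap {E : Type*} [Zero E] (f : ℂ → E) {x : ℝ × ℝ}
    (hx : x ∈ polarCoord.target) :
    (Metric.ball (0 : ℂ) 1).indicator f (circleMap 0 x.1 x.2) =
      (Set.Iio 1 ×ˢ Set.univ : Set (ℝ × ℝ)).indicator (fun x => f (circleMap 0 x.1 x.2)) x := by
  have h0 : 0 < x.1 := hx.1
  have : circleMap 0 x.1 x.2 ∈ Metric.ball (0 : ℂ) 1 ↔
      x ∈ (Set.Iio 1 ×ˢ Set.univ : Set (ℝ × ℝ)) := by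
    simp [circleMap, abs_of_pos h0]
  simp only [Set.indicator, this]

theorem polarCoord_target_inter :
    (Set.Iio 1 ×ˢ Set.univ : Set (ℝ × ℝ)) ∩ polarCoord.target =
      Set.Ioo 0 1 ×ˢ Set.Ioo (-Real.pi) Real.pi := by
  ext x
  simp only [polarCoord_target, Set.mem_inter_iff, Set.mem_prod, Set.mem_Iio, Set.mem_univ,
    and_true, Set.mem_Ioi, Set.mem_Ioo]
  tauto

/-- Integration over the disc in polar coordinates, for nonnegative functions. -/
theorem lintegral_ball_polar (f : ℂ → ℝ≥0∞) :
    ∫⁻ z in Metric.ball (0 : ℂ) 1, f z =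
      ∫⁻ x in Set.Ioo (0 : ℝ) 1 ×ˢ Set.Ioo (-Real.pi) Real.pi,
        ENNReal.ofReal x.1 * f (circleMap 0 x.1 x.2) := by
  have hm : MeasurableSet (Set.Iio 1 ×ˢ Set.univ : Set (ℝ × ℝ)) :=
    measurableSet_Iio.prod MeasurableSet.univ
  rw [← lintegral_indicator Metric.isOpen_ball.measurableSet,
    ← Complex.lintegral_comp_polarCoord_symm, ← polarCoord_target_inter,
    ← Measure.restrict_restrict hm, ← lintegral_indicator hm]
  refine setLIntegral_congr_fun polarCoord.open_target.measurableSet fun x hx => ?_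
  rw [complex_polarCoord_symm_eq_circleMap, indicator_ball_circleMap f hx]
  by_cases h : x ∈ (Set.Iio 1 ×ˢ Set.univ : Set (ℝ × ℝ)) <;> simp [Set.indicator, h]

/-- Integration over the disc in polar coordinates. -/
theorem integral_ball_polar (f : ℂ → ℂ) :
    ∫ z in Metric.ball (0 : ℂ) 1, f z =
      ∫ x in Set.Ioo (0 : ℝ) 1 ×ˢ Set.Ioo (-Real.pi) Real.pi,
        x.1 • f (circleMap 0 x.1 x.2) := by
  have hm : MeasurableSet (Set.Iio 1 ×ˢ Set.univ : Set (ℝ × ℝ)) :=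
    measurableSet_Iio.prod MeasurableSet.univ
  rw [← integral_indicator Metric.isOpen_ball.measurableSet,
    ← Complex.integral_comp_polarCoord_symm, ← polarCoord_target_inter,
    ← Measure.restrict_restrict hm, ← integral_indicator hm]
  refine setIntegral_congr_fun polarCoord.open_target.measurableSet fun x hx => ?_
  simp only [complex_polarCoord_symm_eq_circleMap, indicator_ball_circleMap f hx]
  by_cases h : x ∈ (Set.Iio 1 ×ˢ Set.univ : Set (ℝ × ℝ)) <;> simp [Set.indicator, h]

/-! ### Schur's test -/

/-- Schur's test for nonnegative kernels. -/
theorem lintegral_schur_test {α : Type*} [MeasurableSpace α] {μ : Measure α} [SFinite μ]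
    {p q : ℝ} (hpq : p.HolderConjugate q) {κ : α → α → ℝ≥0∞}
    (hκ : Measurable (Function.uncurry κ)) {w : α → ℝ≥0∞} (hw : Measurable w)
    (hw0 : ∀ x, w x ≠ 0) (hwt : ∀ x, w x ≠ ∞) {A B : ℝ≥0∞}
    (hA : ∀ x, ∫⁻ y, κ x y * w y ^ q ∂μ ≤ A * w x ^ q)
    (hB : ∀ y, ∫⁻ x, κ x y * w x ^ p ∂μ ≤ B * w y ^ p)
    {u : α → ℝ≥0∞} (hu : AEMeasurable u μ) :
    ∫⁻ x, (∫⁻ y, κ x y * u y ∂μ) ^ p ∂μ ≤ A ^ (p / q) * B * ∫⁻ y, u y ^ p ∂μ := by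
  wlog hu' : Measurable u generalizing u
  · have h1 : ∀ x, ∫⁻ y, κ x y * u y ∂μ = ∫⁻ y, κ x y * hu.mk u y ∂μ := fun x =>
      lintegral_congr_ae (hu.ae_eq_mk.mono fun y hy => by simp only [hy])
    have h2 : ∫⁻ y, u y ^ p ∂μ = ∫⁻ y, hu.mk u y ^ p ∂μ :=
      lintegral_congr_ae (hu.ae_eq_mk.mono fun y hy => by simp only [hy])
    simp only [h1, h2]
    exact this hu.measurable_mk.aemeasurable hu.measurable_mk
  have hp := hpq.pos
  have hq := hpq.symm.pos
  have hκx : ∀ x, Measurable (κ x) := fun x => hκ.of_uncurry_left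
  have key : ∀ x, (∫⁻ y, κ x y * u y ∂μ) ^ p ≤
      A ^ (p / q) * ∫⁻ y, (w x ^ p * κ x y) * (u y ^ p * (w y ^ p)⁻¹) ∂μ := by
    intro x
    -- Hölder for the splitting `κ u = (κ^(1/p) u w⁻¹) (κ^(1/q) w)`: the second factor is controlled
    -- by `hA`. After Tonelli, the weight left on the first is absorbed by `hB`.
    have h1 := ENNReal.lintegral_mul_le_Lp_mul_Lq μ hpq
      (f := fun y => κ x y ^ (1 / p) * (u y * (w y)⁻¹))
      (g := fun y => κ x y ^ (1 / q) * w y)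
      (((hκx x).pow_const _).mul (hu'.mul hw.inv)).aemeasurable
      (((hκx x).pow_const _).mul hw).aemeasurable
    have e1 : ∀ y, ((fun y => κ x y ^ (1 / p) * (u y * (w y)⁻¹)) *
        (fun y => κ x y ^ (1 / q) * w y)) y = κ x y * u y := by
      intro y
      have : κ x y ^ (1 / p) * κ x y ^ (1 / q) = κ x y := by
        rw [← ENNReal.rpow_add_of_nonneg _ _ (by positivity) (by positivity), one_div, one_div,
          hpq.inv_add_inv_eq_one, ENNReal.rpow_one]
      calc _ = (κ x y ^ (1 / p) * κ x y ^ (1 / q)) * u y * ((w y)⁻¹ * w y) := by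
            simp only [Pi.mul_apply]; ring
        _ = _ := by rw [this, ENNReal.inv_mul_cancel (hw0 y) (hwt y), mul_one]
    have e2 : ∀ y, (κ x y ^ (1 / p) * (u y * (w y)⁻¹)) ^ p =
        κ x y * (u y ^ p * (w y ^ p)⁻¹) := by
      intro y
      rw [ENNReal.mul_rpow_of_nonneg _ _ hp.le, ENNReal.mul_rpow_of_nonneg _ _ hp.le,
        ← ENNReal.rpow_mul, one_div_mul_cancel hp.ne', ENNReal.rpow_one, ENNReal.inv_rpow]
    have e3 : ∀ y, (κ x y ^ (1 / q) * w y) ^ q = κ x y * w y ^ q := by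
      intro y
      rw [ENNReal.mul_rpow_of_nonneg _ _ hq.le,
        ← ENNReal.rpow_mul, one_div_mul_cancel hq.ne', ENNReal.rpow_one]
    simp only [e1, e2, e3] at h1
    calc _ ≤ ((∫⁻ y, κ x y * (u y ^ p * (w y ^ p)⁻¹) ∂μ) ^ (1 / p) *
          (A * w x ^ q) ^ (1 / q)) ^ p := by
          gcongr
          exact h1.trans (by gcongr; exact hA x)
      _ = (∫⁻ y, κ x y * (u y ^ p * (w y ^ p)⁻¹) ∂μ) * (A ^ (p / q) * w x ^ p) := by
          rw [ENNReal.mul_rpow_of_nonneg _ _ hp.le, ← ENNReal.rpow_mul,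
            one_div_mul_cancel hp.ne', ENNReal.rpow_one, ← ENNReal.rpow_mul,
            ENNReal.mul_rpow_of_nonneg _ _ (by positivity), ← ENNReal.rpow_mul]
          congr 3 <;> field_simp
      _ = _ := by
          simp only [mul_assoc]
          rw [lintegral_const_mul]
          · ring
          · exact (hκx x).mul ((hu'.pow_const _).mul (hw.pow_const _).inv)
  have hm : Measurable (Function.uncurry fun x y =>
      (w x ^ p * κ x y) * (u y ^ p * (w y ^ p)⁻¹)) := by
    have h1 : Measurable fun z : α × α => w z.1 ^ p := (hw.comp measurable_fst).pow_const _
    have h2 : Measurable fun z : α × α => u z.2 ^ p * (w z.2 ^ p)⁻¹ :=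
      ((hu'.pow_const p).mul (hw.pow_const p).inv).comp measurable_snd
    exact (h1.mul hκ).mul h2
  calc _ ≤ ∫⁻ x, A ^ (p / q) * ∫⁻ y, (w x ^ p * κ x y) * (u y ^ p * (w y ^ p)⁻¹) ∂μ ∂μ :=
        lintegral_mono key
    _ = A ^ (p / q) * ∫⁻ y, ∫⁻ x, (w x ^ p * κ x y) * (u y ^ p * (w y ^ p)⁻¹) ∂μ ∂μ := by
        rw [lintegral_const_mul _ hm.lintegral_prod_right, lintegral_lintegral_swap hm.aemeasurable]
    _ ≤ A ^ (p / q) * ∫⁻ y, B * u y ^ p ∂μ := by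
        gcongr with y
        have hmy : Measurable fun x => w x ^ p * κ x y :=
          (hw.pow_const _).mul hκ.of_uncurry_right
        rw [lintegral_mul_const _ hmy]
        calc _ ≤ (B * w y ^ p) * (u y ^ p * (w y ^ p)⁻¹) := by
              gcongr
              simpa only [mul_comm] using hB y
          _ = B * u y ^ p * (w y ^ p * (w y ^ p)⁻¹) := by ring
          _ = _ := by
              rw [ENNReal.mul_inv_cancel, mul_one]
              · exact (ENNReal.rpow_pos (pos_iff_ne_zero.2 (hw0 y)) (hwt y)).ne'
              · exact ENNReal.rpow_ne_top_of_nonneg hp.le (hwt y)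
    _ = _ := by rw [lintegral_const_mul _ (hu'.pow_const _), mul_assoc]

/-! ### The Forelli–Rudin estimate -/

theorem circleAverage_eq_setIntegral_Ioo {E : Type*} [NormedAddCommGroup E] [NormedSpace ℝ E]
    (f : ℂ → E) (c : ℂ) (R : ℝ) :
    Real.circleAverage f c R =
      (2 * Real.pi)⁻¹ • ∫ θ in Set.Ioo (-Real.pi) Real.pi, f (circleMap c R θ) := by
  rw [Real.circleAverage_eq_integral_add (-Real.pi),
    intervalIntegral.integral_comp_add_right (fun θ => f (circleMap c R θ)),
    intervalIntegral.integral_of_le (by linarith [Real.pi_pos]), integral_Ioc_eq_integral_Ioo]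
  congr 4 <;> ring

theorem one_sub_conj_mul_ne_zero {z w : ℂ} (hz : ‖z‖ ≤ 1) (hw : ‖w‖ < 1) :
    1 - conj z * w ≠ 0 := by
  intro h
  have h1 : ‖conj z * w‖ = 1 := by rw [← sub_eq_zero.1 h, norm_one]
  rw [norm_mul, RCLike.norm_conj] at h1
  nlinarith [norm_nonneg z, norm_nonneg w]

/-- For `|u| = 1` one has `|1 - conj(u) w| = |u - w|`, so up to the factor `1 - |w|^2` the integrand
is the Poisson kernel, whose circle average is `1`. -/
theorem lintegral_Ioo_circleMap_kernel {w : ℂ} (hw : ‖w‖ < 1) :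
    ∫⁻ θ in Set.Ioo (-Real.pi) Real.pi,
      ENNReal.ofReal ((‖1 - conj (circleMap 0 1 θ) * w‖ ^ 2)⁻¹) =
        ENNReal.ofReal (2 * Real.pi / (1 - ‖w‖ ^ 2)) := by
  have hd : DiffContOnCl ℂ (fun _ : ℂ => (1 : ℂ)) (Metric.ball 0 1) := diffContOnCl_const
  have h1 := hd.circleAverage_poissonKernel_smul' (w := w) (by simpa using hw)
  have hpos : 0 < 1 - ‖w‖ ^ 2 := by nlinarith [norm_nonneg w]
  have hn : ∀ θ, ‖circleMap 0 1 θ - w‖ = ‖1 - conj (circleMap 0 1 θ) * w‖ := by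
    intro θ
    have h2 : circleMap 0 1 θ * conj (circleMap 0 1 θ) = 1 := by
      rw [Complex.mul_conj, Complex.normSq_eq_norm_sq]; simp
    have h3 : circleMap 0 1 θ - w = circleMap 0 1 θ * (1 - conj (circleMap 0 1 θ) * w) := by
      linear_combination w * h2
    rw [h3, norm_mul]; simp
  rw [circleAverage_eq_setIntegral_Ioo] at h1
  have h4 : ∀ θ, ((‖circleMap 0 1 θ - 0‖ ^ 2 - ‖w - 0‖ ^ 2) /
      ‖circleMap 0 1 θ - 0 - (w - 0)‖ ^ 2) • (1 : ℂ) =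
      (((1 - ‖w‖ ^ 2) * (‖1 - conj (circleMap 0 1 θ) * w‖ ^ 2)⁻¹ : ℝ) : ℂ) := by
    intro θ
    rw [sub_zero, sub_zero, hn]
    simp [div_eq_mul_inv]
  simp only [h4] at h1
  rw [integral_complex_ofReal, integral_const_mul, Complex.real_smul, ← Complex.ofReal_mul,
    Complex.ofReal_eq_one] at h1
  have hc : Continuous fun θ : ℝ => (‖1 - conj (circleMap 0 1 θ) * w‖ ^ 2)⁻¹ := by
    refine Continuous.inv₀ (by fun_prop) fun θ => ?_
    have := one_sub_conj_mul_ne_zero (z := circleMap 0 1 θ) (by simp) hw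
    positivity
  rw [← ofReal_integral_eq_lintegral_ofReal
    ((hc.integrableOn_Icc).mono_set Set.Ioo_subset_Icc_self)
    (Filter.Eventually.of_forall fun θ => by positivity)]
  congr 1
  have := Real.pi_pos
  generalize ∫ θ in Set.Ioo (-Real.pi) Real.pi,
    (‖1 - conj (circleMap 0 1 θ) * w‖ ^ 2)⁻¹ = J at h1 ⊢
  field_simp at h1 ⊢
  linarith

/-- The radial part of the estimate, with `s = 1 - ρ` and `δ = 1 - |z|^2`. Splitting at `s = δ`
gives `δ^(-a) / (1 - a)` from the left and `δ^(-a) / a` from the right. -/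
theorem lintegral_Ioi_rpow_div_max_le {a δ : ℝ} (ha : 0 < a) (ha1 : a < 1) (hδ : 0 < δ) :
    ∫⁻ s in Set.Ioi (0 : ℝ), ENNReal.ofReal (s ^ (-a) / max s δ) ≤
      ENNReal.ofReal (1 / (1 - a) + 1 / a) * ENNReal.ofReal (δ ^ (-a)) := by
  have hu : Set.Ioi (0 : ℝ) = Set.Ioc 0 δ ∪ Set.Ioi δ := (Set.Ioc_union_Ioi_eq_Ioi hδ.le).symm
  have e1 : δ⁻¹ * δ ^ (1 - a) = δ ^ (-a) := by
    rw [← Real.rpow_neg_one, ← Real.rpow_add hδ]; congr 1; ring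
  have hI : IntervalIntegrable (fun s : ℝ => s ^ (-a)) volume 0 δ :=
    intervalIntegral.intervalIntegrable_rpow' (by linarith)
  have b1 : ∫⁻ s in Set.Ioc 0 δ, ENNReal.ofReal (s ^ (-a) / max s δ) =
      ENNReal.ofReal (1 / (1 - a) * δ ^ (-a)) := by
    have : ∫⁻ s in Set.Ioc 0 δ, ENNReal.ofReal (s ^ (-a) / max s δ) =
        ∫⁻ s in Set.Ioc 0 δ, ENNReal.ofReal (δ⁻¹ * s ^ (-a)) :=
      setLIntegral_congr_fun measurableSet_Ioc fun s hs => by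
        rw [max_eq_right hs.2, div_eq_inv_mul]
    rw [this, ← ofReal_integral_eq_lintegral_ofReal]
    · congr 1
      rw [integral_const_mul, ← intervalIntegral.integral_of_le hδ.le,
        integral_rpow (Or.inl (by linarith)), Real.zero_rpow (by linarith), sub_zero, ← e1,
        show -a + 1 = 1 - a by ring]
      ring
    · exact ((intervalIntegrable_iff_integrableOn_Ioc_of_le hδ.le).1 hI).const_mul _
    · refine (ae_restrict_iff' measurableSet_Ioc).2 (Filter.Eventually.of_forall fun s hs => ?_)
      have := hs.1
      simp only [Pi.zero_apply]; positivity
  have b2 : ∫⁻ s in Set.Ioi δ, ENNReal.ofReal (s ^ (-a) / max s δ) =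
      ENNReal.ofReal (1 / a * δ ^ (-a)) := by
    have : ∫⁻ s in Set.Ioi δ, ENNReal.ofReal (s ^ (-a) / max s δ) =
        ∫⁻ s in Set.Ioi δ, ENNReal.ofReal (s ^ (-a - 1)) :=
      setLIntegral_congr_fun measurableSet_Ioi fun s (hs : δ < s) => by
        rw [max_eq_left hs.le, Real.rpow_sub_one (hδ.trans hs).ne']
    rw [this, ← ofReal_integral_eq_lintegral_ofReal]
    · congr 1
      rw [integral_Ioi_rpow_of_lt (by linarith) hδ, show -a - 1 + 1 = -a by ring]
      field_simp
    · exact integrableOn_Ioi_rpow_of_lt (by linarith) hδ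
    · refine (ae_restrict_iff' measurableSet_Ioi).2 (Filter.Eventually.of_forall fun s hs => ?_)
      have := hδ.trans hs
      simp only [Pi.zero_apply]; positivity
  have h1a : 0 < 1 - a := by linarith
  rw [hu, ← ENNReal.ofReal_mul (by positivity), add_mul,
    ENNReal.ofReal_add (by positivity) (by positivity)]
  refine (lintegral_union_le _ _ _).trans ?_
  rw [b1, b2]

/-- The Forelli--Rudin estimate for the modulus of the Bergman kernel. -/
theorem lintegral_kernel_mul_rpow_le {a : ℝ} (ha : 0 < a) (ha1 : a < 1) (z : Disc) :
    ∫⁻ ζ : Disc, ENNReal.ofReal ((‖1 - conj (ζ : ℂ) * (z : ℂ)‖ ^ 2)⁻¹) *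
        ENNReal.ofReal ((1 - ‖(ζ : ℂ)‖ ^ 2) ^ (-a)) ∂discMeasure ≤
      (2 * ENNReal.ofReal (1 / (1 - a) + 1 / a)) *
        ENNReal.ofReal ((1 - ‖(z : ℂ)‖ ^ 2) ^ (-a)) := by
  obtain ⟨z, hz⟩ := z
  have hz1 : ‖z‖ < 1 := by simpa using hz
  set δ := 1 - ‖z‖ ^ 2 with hδd
  have hδ : 0 < δ := by nlinarith [norm_nonneg z]
  have hπ := Real.pi_pos
  rw [lintegral_discMeasure (fun ζ => ENNReal.ofReal ((‖1 - conj ζ * z‖ ^ 2)⁻¹) *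
        ENNReal.ofReal ((1 - ‖ζ‖ ^ 2) ^ (-a))), lintegral_ball_polar, Measure.volume_eq_prod,
    ← Measure.prod_restrict, lintegral_prod]
  swap
  · refine Measurable.aemeasurable ?_
    have : Measurable fun x : ℝ × ℝ => circleMap 0 x.1 x.2 := by
      unfold circleMap; fun_prop
    fun_prop
  -- Moving the factor `ρ` from `ζ` to `z` turns the angular integral into the Poisson one, equal to
  -- `2π / (1 - ρ^2 |z|^2)`; this denominator is at least both `1 - ρ` and `δ`.
  have inner : ∀ ρ ∈ Set.Ioo (0 : ℝ) 1,
      ∫⁻ θ in Set.Ioo (-Real.pi) Real.pi, ENNReal.ofReal ρ *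
        (ENNReal.ofReal ((‖1 - conj (circleMap 0 ρ θ) * z‖ ^ 2)⁻¹) *
        ENNReal.ofReal ((1 - ‖circleMap 0 ρ θ‖ ^ 2) ^ (-a))) ≤
      ENNReal.ofReal (2 * Real.pi) * ENNReal.ofReal ((1 - ρ) ^ (-a) / max (1 - ρ) δ) := by
    intro ρ ⟨h0, h1⟩
    have e1 : ∀ θ, conj (circleMap 0 ρ θ) * z = conj (circleMap 0 1 θ) * (ρ * z) := by
      intro θ; simp [circleMap]; ring
    have e2 : ∀ θ, ‖circleMap 0 ρ θ‖ = ρ := by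
      intro θ; simp [abs_of_pos h0]
    have hρz : ‖(ρ : ℂ) * z‖ < 1 := by
      rw [norm_mul, Complex.norm_real, Real.norm_eq_abs, abs_of_pos h0]
      nlinarith [norm_nonneg z]
    have hm : Measurable fun θ : ℝ => ENNReal.ofReal
        ((‖1 - conj (circleMap 0 1 θ) * (ρ * z)‖ ^ 2)⁻¹) := by
      unfold circleMap; fun_prop
    simp only [e1, e2]
    rw [lintegral_const_mul _ (hm.mul_const _), lintegral_mul_const _ hm,
      lintegral_Ioo_circleMap_kernel hρz, norm_mul, Complex.norm_real, Real.norm_eq_abs,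
      abs_of_pos h0]
    have hρ1 : 0 < 1 - ρ := by linarith
    have hρ2 : 1 - ρ ≤ 1 - ρ ^ 2 := by nlinarith
    have hd : max (1 - ρ) δ ≤ 1 - (ρ * ‖z‖) ^ 2 := by
      refine max_le ?_ ?_
      · have : (ρ * ‖z‖) ^ 2 ≤ ρ ^ 2 := by
          rw [mul_pow]; nlinarith [norm_nonneg z, sq_nonneg ρ]
        linarith
      · have : (ρ * ‖z‖) ^ 2 ≤ ‖z‖ ^ 2 := by
          rw [mul_pow]; nlinarith [norm_nonneg z, sq_nonneg ‖z‖]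
        linarith
    have hm0 : 0 < max (1 - ρ) δ := lt_max_of_lt_left hρ1
    have hd0 : 0 < 1 - (ρ * ‖z‖) ^ 2 := hm0.trans_le hd
    have hr : (1 - ρ ^ 2) ^ (-a) ≤ (1 - ρ) ^ (-a) :=
      Real.rpow_le_rpow_of_nonpos hρ1 hρ2 (by linarith)
    have hr0 : 0 ≤ (1 - ρ ^ 2) ^ (-a) := Real.rpow_nonneg (by linarith) _
    rw [← ENNReal.ofReal_mul (by positivity), ← ENNReal.ofReal_mul h0.le,
      ← ENNReal.ofReal_mul (by positivity)]
    apply ENNReal.ofReal_le_ofReal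
    calc _ ≤ 1 * (2 * Real.pi / max (1 - ρ) δ * (1 - ρ) ^ (-a)) := by
          gcongr
      _ = _ := by ring
  calc _ ≤ (ENNReal.ofReal Real.pi)⁻¹ * ∫⁻ ρ in Set.Ioo (0 : ℝ) 1,
        ENNReal.ofReal (2 * Real.pi) * ENNReal.ofReal ((1 - ρ) ^ (-a) / max (1 - ρ) δ) := by
        gcongr 1
        exact setLIntegral_mono' measurableSet_Ioo inner
    _ = 2 * ∫⁻ ρ in Set.Ioo (0 : ℝ) 1, ENNReal.ofReal ((1 - ρ) ^ (-a) / max (1 - ρ) δ) := by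
        rw [lintegral_const_mul _ (by fun_prop), ← mul_assoc]
        congr 1
        rw [ENNReal.ofReal_mul (by norm_num), mul_left_comm, ENNReal.inv_mul_cancel
          (by simpa using hπ) ENNReal.ofReal_ne_top]
        simp
    _ ≤ 2 * ∫⁻ s in Set.Ioi (0 : ℝ), ENNReal.ofReal (s ^ (-a) / max s δ) := by
        gcongr 1
        rw [← lintegral_indicator measurableSet_Ioi, ← lintegral_indicator measurableSet_Ioo,
          ← lintegral_sub_left_eq_self _ (1 : ℝ)]
        refine lintegral_mono fun ρ => ?_
        by_cases h : 1 - ρ ∈ Set.Ioo (0 : ℝ) 1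
        · rw [Set.indicator_of_mem h, Set.indicator_of_mem (by simpa using h.2), sub_sub_cancel]
        · rw [Set.indicator_of_notMem h]; exact zero_le
    _ ≤ _ := by
        rw [mul_assoc]
        gcongr 1
        exact lintegral_Ioi_rpow_div_max_le ha ha1 hδ

/-! ### The Bergman projection: analyticity, boundedness, self-adjointness -/

theorem Disc.norm_lt_one (z : Disc) : ‖(z : ℂ)‖ < 1 := mem_ball_zero_iff.1 z.2

theorem one_sub_norm_le_norm_one_sub_conj_mul (ζ : Disc) (z : ℂ) :
    1 - ‖z‖ ≤ ‖1 - conj (ζ : ℂ) * z‖ := by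
  have h1 := norm_sub_norm_le (1 : ℂ) (conj (ζ : ℂ) * z)
  rw [norm_one, norm_mul, RCLike.norm_conj] at h1
  nlinarith [norm_nonneg z, ζ.norm_lt_one]

theorem bergmanKernel_ne_zero (ζ : Disc) {z : ℂ} (hz : ‖z‖ < 1) :
    (1 - conj (ζ : ℂ) * z) ^ 2 ≠ 0 :=
  pow_ne_zero _ (one_sub_conj_mul_ne_zero ζ.norm_lt_one.le hz)

theorem enorm_div_bergmanKernel (w : ℂ) (z ζ : Disc) :
    ‖w / (1 - conj (ζ : ℂ) * (z : ℂ)) ^ 2‖ₑ =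
      ENNReal.ofReal ((‖1 - conj (ζ : ℂ) * (z : ℂ)‖ ^ 2)⁻¹) * ‖w‖ₑ := by
  rw [div_eq_mul_inv, enorm_mul, mul_comm, ← ofReal_norm ((_ : ℂ)⁻¹), norm_inv, norm_pow]

theorem Integrable.div_bergmanKernel {f : Disc → ℂ} (hf : Integrable f discMeasure) {z : ℂ}
    (hz : ‖z‖ < 1) : Integrable (fun ζ : Disc => f ζ / (1 - conj (ζ : ℂ) * z) ^ 2) discMeasure := by
  simp only [div_eq_mul_inv]
  refine hf.mul_bdd (c := ((1 - ‖z‖) ^ 2)⁻¹) ?_ ?_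
  · exact (Continuous.inv₀ (by fun_prop) fun ζ =>
      bergmanKernel_ne_zero ζ hz).aestronglyMeasurable
  · refine Filter.Eventually.of_forall fun ζ => ?_
    have h1 := one_sub_norm_le_norm_one_sub_conj_mul ζ z
    have h2 : 0 < 1 - ‖z‖ := by linarith
    rw [norm_inv, norm_pow]
    gcongr

/-- Differentiation under the integral: within `ε = (1 - |z₀|) / 2` of `z₀` the kernel's denominator
stays away from `0` uniformly in `ζ`, so `|f|` times a constant dominates. -/
theorem discAnalytic_bergmanProjection {f : Disc → ℂ} (hf : Integrable f discMeasure) :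
    DiscAnalytic (bergmanProjection f) := by
  refine ⟨fun z => ∫ ζ : Disc, f ζ / (1 - conj (ζ : ℂ) * z) ^ 2 ∂discMeasure, ?_, fun z => rfl⟩
  intro z₀ hz₀
  have hz₀' : ‖z₀‖ < 1 := by simpa using hz₀
  set ε := (1 - ‖z₀‖) / 2 with hε
  have hε0 : 0 < ε := by rw [hε]; linarith
  have hball : ∀ z ∈ Metric.ball z₀ ε, ‖z‖ < 1 - ε := by
    intro z hz
    have h1 : ‖z - z₀‖ < ε := by simpa [dist_eq_norm] using hz
    have h2 := norm_sub_norm_le z z₀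
    linarith
  refine DifferentiableAt.differentiableWithinAt ?_
  refine (hasDerivAt_integral_of_dominated_loc_of_deriv_le (Metric.ball_mem_nhds z₀ hε0)
    (F' := fun z ζ => f ζ * (2 * conj (ζ : ℂ) / (1 - conj (ζ : ℂ) * z) ^ 3))
    (bound := fun ζ => ‖f ζ‖ * (2 / ε ^ 3)) ?_ (Integrable.div_bergmanKernel hf hz₀') ?_ ?_
    (hf.norm.mul_const _) ?_).2.differentiableAt
  · filter_upwards [Metric.ball_mem_nhds z₀ hε0] with z hz
    exact (Integrable.div_bergmanKernel hf (by linarith [hball z hz])).1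
  · refine hf.1.mul (Continuous.aestronglyMeasurable ?_)
    refine Continuous.div (by fun_prop) (by fun_prop) fun ζ => pow_ne_zero _ ?_
    exact one_sub_conj_mul_ne_zero ζ.norm_lt_one.le hz₀'
  · refine Filter.Eventually.of_forall fun ζ z hz => ?_
    have h1 := one_sub_norm_le_norm_one_sub_conj_mul ζ z
    have h2 := hball z hz
    have h3 : ε ≤ ‖1 - conj (ζ : ℂ) * z‖ := by linarith
    rw [norm_mul, norm_div, norm_pow, norm_mul, RCLike.norm_conj, Complex.norm_ofNat]
    have h4 := ζ.norm_lt_one.le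
    gcongr
    linarith
  · refine Filter.Eventually.of_forall fun ζ z hz => ?_
    have h1 := one_sub_conj_mul_ne_zero (z := (ζ : ℂ)) ζ.norm_lt_one.le
      (show ‖z‖ < 1 by linarith [hball z hz])
    have h2 : HasDerivAt (fun z => 1 - conj (ζ : ℂ) * z) (-conj (ζ : ℂ)) z := by
      simpa using ((hasDerivAt_id z).const_mul (conj (ζ : ℂ))).const_sub 1
    have h3 := ((h2.fun_pow 2).fun_inv (pow_ne_zero 2 h1)).const_mul (f ζ)
    simp only [div_eq_mul_inv]
    refine h3.congr_deriv ?_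
    field_simp
    ring

/-- The Bergman projection with the modulus of the kernel satisfies an `L ^ p` estimate. -/
theorem exists_lintegral_kernel_rpow_le {p q : ℝ} (hpq : p.HolderConjugate q) :
    ∃ C : ℝ≥0∞, C ≠ ∞ ∧ ∀ u : Disc → ℝ≥0∞, AEMeasurable u discMeasure →
      ∫⁻ z : Disc, (∫⁻ ζ : Disc, ENNReal.ofReal ((‖1 - conj (ζ : ℂ) * (z : ℂ)‖ ^ 2)⁻¹) * u ζ
        ∂discMeasure) ^ p ∂discMeasure ≤ C * ∫⁻ ζ, u ζ ^ p ∂discMeasure := by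
  have hp := hpq.pos
  have hq := hpq.symm.pos
  have hpos : ∀ z : Disc, 0 < 1 - ‖(z : ℂ)‖ ^ 2 := fun z => by
    nlinarith [z.norm_lt_one, norm_nonneg (z : ℂ)]
  -- The Schur weight is `w = (1 - |z|^2)^(-1/(pq))`: then `w^q` and `w^p` have exponents `-1/p` and
  -- `-1/q`, both in the range `(-1, 0)` of the Forelli–Rudin estimate.
  have hw : ∀ (r s : ℝ), 0 < s → ∀ z : Disc,
      ENNReal.ofReal ((1 - ‖(z : ℂ)‖ ^ 2) ^ (-(1 / (r * s)))) ^ s =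
        ENNReal.ofReal ((1 - ‖(z : ℂ)‖ ^ 2) ^ (-(1 / r))) := by
    intro r s hs z
    rw [ENNReal.ofReal_rpow_of_pos (Real.rpow_pos_of_pos (hpos z) _), ← Real.rpow_mul (hpos z).le]
    congr 2
    field_simp
  refine ⟨_, ?_, fun u hu => lintegral_schur_test hpq
    (κ := fun z ζ : Disc => ENNReal.ofReal ((‖1 - conj (ζ : ℂ) * (z : ℂ)‖ ^ 2)⁻¹))
    (w := fun z : Disc => ENNReal.ofReal ((1 - ‖(z : ℂ)‖ ^ 2) ^ (-(1 / (p * q)))))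
    (A := 2 * ENNReal.ofReal (1 / (1 - 1 / p) + 1 / (1 / p)))
    (B := 2 * ENNReal.ofReal (1 / (1 - 1 / q) + 1 / (1 / q))) ?_ ?_ ?_ ?_ ?_ ?_ hu⟩
  · refine ENNReal.mul_ne_top (ENNReal.rpow_ne_top_of_nonneg (by positivity) ?_) ?_ <;>
    exact ENNReal.mul_ne_top (by simp) ENNReal.ofReal_ne_top
  · unfold Function.uncurry; fun_prop
  · fun_prop
  · intro z
    have := Real.rpow_pos_of_pos (hpos z) (-(1 / (p * q)))
    simpa using this
  · exact fun z => ENNReal.ofReal_ne_top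
  · intro z
    simp only [hw p q hq]
    refine lintegral_kernel_mul_rpow_le (by positivity) ?_ z
    rw [div_lt_one hp]; exact hpq.lt
  · intro ζ
    simp only [mul_comm p q, hw q p hp]
    have hs : ∀ z : Disc, ‖1 - conj (ζ : ℂ) * (z : ℂ)‖ = ‖1 - conj (z : ℂ) * (ζ : ℂ)‖ := by
      intro z
      rw [← RCLike.norm_conj]; simp [mul_comm]
    simp only [hs]
    refine lintegral_kernel_mul_rpow_le (by positivity) ?_ ζ
    rw [div_lt_one hq]; exact hpq.symm.lt

theorem MeasureTheory.MemLp.integrable_discMeasure {p : ℝ} (hp : 1 < p) {f : Disc → ℂ}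
    (hf : MemLp f (ENNReal.ofReal p) discMeasure) : Integrable f discMeasure :=
  hf.integrable (ENNReal.one_le_ofReal.2 hp.le)

theorem enorm_bergmanProjection_le (f : Disc → ℂ) (z : Disc) :
    ‖bergmanProjection f z‖ₑ ≤
      ∫⁻ ζ : Disc, ENNReal.ofReal ((‖1 - conj (ζ : ℂ) * (z : ℂ)‖ ^ 2)⁻¹) * ‖f ζ‖ₑ ∂discMeasure := by
  refine (enorm_integral_le_lintegral_enorm _).trans_eq ?_
  simp only [enorm_div_bergmanKernel]

/-- The Bergman projection is bounded on `L ^ p` for `1 < p < ∞`. -/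
theorem exists_eLpNorm_bergmanProjection_le {p q : ℝ} (hpq : p.HolderConjugate q) :
    ∃ C : ℝ≥0∞, C ≠ ∞ ∧ ∀ f : Disc → ℂ, MemLp f (ENNReal.ofReal p) discMeasure →
      eLpNorm (bergmanProjection f) (ENNReal.ofReal p) discMeasure ≤
        C * eLpNorm f (ENNReal.ofReal p) discMeasure := by
  obtain ⟨C, hC, h⟩ := exists_lintegral_kernel_rpow_le hpq
  have hp := hpq.pos
  refine ⟨C ^ (1 / p), ENNReal.rpow_ne_top_of_nonneg (by positivity) hC, fun f hf => ?_⟩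
  have hp0 : ENNReal.ofReal p ≠ 0 := by simpa using hp
  rw [eLpNorm_eq_lintegral_rpow_enorm_toReal hp0 ENNReal.ofReal_ne_top,
    eLpNorm_eq_lintegral_rpow_enorm_toReal hp0 ENNReal.ofReal_ne_top, ENNReal.toReal_ofReal hp.le,
    ← ENNReal.mul_rpow_of_nonneg _ _ (by positivity)]
  gcongr
  refine le_trans ?_ (h _ hf.1.enorm)
  gcongr with z
  exact enorm_bergmanProjection_le f z

theorem memLp_bergmanProjection {p q : ℝ} (hpq : p.HolderConjugate q) {f : Disc → ℂ}
    (hf : MemLp f (ENNReal.ofReal p) discMeasure) :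
    MemLp (bergmanProjection f) (ENNReal.ofReal p) discMeasure := by
  obtain ⟨C, hC, h⟩ := exists_eLpNorm_bergmanProjection_le hpq
  exact ⟨(discAnalytic_bergmanProjection
    (hf.integrable_discMeasure hpq.lt)).continuous.aestronglyMeasurable,
    (h f hf).trans_lt (ENNReal.mul_lt_top hC.lt_top hf.2)⟩

/-- The Bergman projection of an `L ^ p` function, as an element of `A ^ p`. -/
noncomputable def bergmanProj {p q : ℝ} (hpq : p.HolderConjugate q) (f : Disc → ℂ)
    (hf : MemLp f (ENNReal.ofReal p) discMeasure) : BergmanSpace p :=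
  ⟨bergmanProjection f, discAnalytic_bergmanProjection (hf.integrable_discMeasure hpq.lt),
    memLp_bergmanProjection hpq hf⟩

/-- The Bergman projection is formally self-adjoint. -/
theorem integral_bergmanProjection_mul_conj {p q : ℝ} (hpq : p.HolderConjugate q)
    {f g : Disc → ℂ} (hf : MemLp f (ENNReal.ofReal p) discMeasure)
    (hg : MemLp g (ENNReal.ofReal q) discMeasure) :
    ∫ z, bergmanProjection f z * conj (g z) ∂discMeasure =
      ∫ ζ, f ζ * conj (bergmanProjection g ζ) ∂discMeasure := by
  have hp := hpq.pos
  have hq := hpq.symm.pos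
  have hK : Continuous fun x : Disc × Disc =>
      ((1 - conj (x.2 : ℂ) * (x.1 : ℂ)) ^ 2)⁻¹ :=
    Continuous.inv₀ (by fun_prop) fun x => bergmanKernel_ne_zero x.2 x.1.norm_lt_one
  -- Fubini needs absolute integrability, hence the `L^p` bound for the operator with kernel `|K|`,
  -- followed by Hölder against `g`.
  have hint : Integrable (Function.uncurry fun z ζ : Disc =>
      f ζ / (1 - conj (ζ : ℂ) * (z : ℂ)) ^ 2 * conj (g z)) (discMeasure.prod discMeasure) := by
    have hm : AEStronglyMeasurable (Function.uncurry fun z ζ : Disc =>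
        f ζ / (1 - conj (ζ : ℂ) * (z : ℂ)) ^ 2 * conj (g z)) (discMeasure.prod discMeasure) := by
      simp only [div_eq_mul_inv]
      exact (hf.1.comp_snd.mul hK.aestronglyMeasurable).mul
        (Complex.continuous_conj.comp_aestronglyMeasurable hg.1.comp_fst)
    refine ⟨hm, ?_⟩
    rw [hasFiniteIntegral_iff_enorm, lintegral_prod _ hm.enorm]
    simp only [Function.uncurry_apply_pair, enorm_mul, enorm_div_bergmanKernel, RCLike.enorm_conj]
    obtain ⟨C, hC, h⟩ := exists_lintegral_kernel_rpow_le hpq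
    have hfin := fun {r : ℝ} (hr : 0 < r) {f : Disc → ℂ}
        (hf : MemLp f (ENNReal.ofReal r) discMeasure) =>
      show ∫⁻ ζ, ‖f ζ‖ₑ ^ r ∂discMeasure < ∞ by
        simpa [ENNReal.toReal_ofReal hr.le] using lintegral_rpow_enorm_lt_top_of_eLpNorm_lt_top
          (by simpa using hr) ENNReal.ofReal_ne_top hf.2
    have hKm : AEMeasurable (Function.uncurry fun z ζ : Disc =>
        ENNReal.ofReal ((‖1 - conj (ζ : ℂ) * (z : ℂ)‖ ^ 2)⁻¹) * ‖f ζ‖ₑ)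
        (discMeasure.prod discMeasure) := by
      refine AEMeasurable.mul (Measurable.aemeasurable (by fun_prop)) hf.1.comp_snd.enorm
    calc _ = ∫⁻ z : Disc, (∫⁻ ζ : Disc,
          ENNReal.ofReal ((‖1 - conj (ζ : ℂ) * (z : ℂ)‖ ^ 2)⁻¹) * ‖f ζ‖ₑ ∂discMeasure) * ‖g z‖ₑ
            ∂discMeasure := lintegral_congr fun z => lintegral_mul_const' _ _ (by simp)
      _ ≤ _ := ENNReal.lintegral_mul_le_Lp_mul_Lq discMeasure hpq
          (hKm.lintegral_prod_right') hg.1.enorm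
      _ < ∞ := ENNReal.mul_lt_top
          (ENNReal.rpow_lt_top_of_nonneg (by positivity)
            ((h _ hf.1.enorm).trans_lt (ENNReal.mul_lt_top hC.lt_top (hfin hp hf))).ne)
          (ENNReal.rpow_lt_top_of_nonneg (by positivity) (hfin hq hg).ne)
  calc _ = ∫ z : Disc, ∫ ζ : Disc, f ζ / (1 - conj (ζ : ℂ) * (z : ℂ)) ^ 2 * conj (g z)
        ∂discMeasure ∂discMeasure := by
        simp only [bergmanProjection, integral_mul_const]
    _ = ∫ ζ : Disc, ∫ z : Disc, f ζ / (1 - conj (ζ : ℂ) * (z : ℂ)) ^ 2 * conj (g z)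
        ∂discMeasure ∂discMeasure := integral_integral_swap hint
    _ = _ := by
        refine integral_congr_ae (Filter.Eventually.of_forall fun ζ => ?_)
        simp only [bergmanProjection]
        rw [← integral_conj, ← integral_const_mul]
        refine integral_congr_ae (Filter.Eventually.of_forall fun z => ?_)
        simp only [map_div₀, map_pow, map_sub, map_one, map_mul, Complex.conj_conj]
        rw [mul_comm (z : ℂ)]
        ring

/-! ### The reproducing formula -/

/-- With `ζ = ρ u`, `|u| = 1`, one has `1 - conj(ζ) z = (u - ρ z) / u`. The integral becomes
Cauchy's formula for the derivative of `u f(ρ u)` at `ρ z`, a function analytic on the disc of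
radius `1/ρ > 1`. -/
theorem integral_circleMap_div_bergmanKernel {f : ℂ → ℂ}
    (hf : DifferentiableOn ℂ f (Metric.ball 0 1)) {z : ℂ} (hz : ‖z‖ < 1) {ρ : ℝ}
    (h0 : 0 < ρ) (h1 : ρ < 1) :
    ∫ θ in Set.Ioo (-Real.pi) Real.pi,
      f (circleMap 0 ρ θ) / (1 - conj (circleMap 0 ρ θ) * z) ^ 2 =
        2 * Real.pi * (f (ρ ^ 2 * z) + ρ ^ 2 * z * deriv f (ρ ^ 2 * z)) := by
  have hρ : ∀ u : ℂ, ‖(ρ : ℂ) * u‖ = ρ * ‖u‖ := fun u => by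
    rw [norm_mul, Complex.norm_real, Real.norm_eq_abs, abs_of_pos h0]
  have hρz : ‖(ρ : ℂ) * z‖ < 1 := by rw [hρ]; nlinarith [norm_nonneg z]
  have hρρz : ‖(ρ : ℂ) * (ρ * z)‖ < 1 := by rw [hρ]; nlinarith [norm_nonneg ((ρ : ℂ) * z)]
  have hmaps : Set.MapsTo (fun u : ℂ => (ρ : ℂ) * u) (Metric.ball 0 ρ⁻¹) (Metric.ball 0 1) := by
    intro u hu
    rw [mem_ball_zero_iff] at hu ⊢
    rw [hρ, ← mul_inv_cancel₀ h0.ne']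
    gcongr
  have hd : DifferentiableOn ℂ (fun u => u * f (ρ * u)) (Metric.ball 0 ρ⁻¹) :=
    differentiableOn_id.mul (hf.comp (by fun_prop) hmaps)
  have hsub : Metric.closedBall (0 : ℂ) 1 ⊆ Metric.ball 0 ρ⁻¹ :=
    Metric.closedBall_subset_ball ((one_lt_inv₀ h0).2 h1)
  have hC := Complex.two_pi_I_inv_smul_circleIntegral_sub_sq_inv_smul_of_differentiable
    Metric.isOpen_ball hsub hd (w₀ := ρ * z) (by simpa using hρz)
  have hfd : HasDerivAt f (deriv f (ρ * (ρ * z))) (ρ * (ρ * z)) :=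
    (hf.differentiableAt (Metric.isOpen_ball.mem_nhds (by simpa using hρρz))).hasDerivAt
  have hderiv : deriv (fun u => u * f (ρ * u)) (ρ * z) =
      f (ρ ^ 2 * z) + ρ ^ 2 * z * deriv f (ρ ^ 2 * z) := by
    have h2 : HasDerivAt (fun u : ℂ => f (ρ * u)) (deriv f (ρ * (ρ * z)) * (ρ * 1)) (ρ * z) :=
      hfd.comp (ρ * z : ℂ) ((hasDerivAt_id (ρ * z : ℂ)).const_mul (ρ : ℂ))
    have h3 := ((hasDerivAt_id (ρ * z : ℂ)).mul h2).deriv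
    have h4 : (ρ : ℂ) ^ 2 * z = ρ * (ρ * z) := by ring
    rw [h4]
    refine h3.trans ?_
    simp only [id]
    ring
  have hA := circleAverage_eq_setIntegral_Ioo
    (fun u : ℂ => f (ρ * u) / (1 - conj u * (ρ * z)) ^ 2) 0 1
  rw [Real.circleAverage_eq_circleIntegral (by norm_num)] at hA
  have hcongr : (∮ u in C(0, 1), (u - 0)⁻¹ • (f (ρ * u) / (1 - conj u * (ρ * z)) ^ 2)) =
      ∮ u in C(0, 1), ((u - ρ * z) ^ 2)⁻¹ • (u * f (ρ * u)) := by
    refine circleIntegral.integral_congr (by norm_num) fun u hu => ?_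
    have hu1 : ‖u‖ = 1 := by simpa using hu
    have hu0 : u ≠ 0 := norm_pos_iff.1 (by rw [hu1]; norm_num)
    have h2 : u * conj u = 1 := by
      rw [Complex.mul_conj, Complex.normSq_eq_norm_sq, hu1]; simp
    have h3 : u - ρ * z = u * (1 - conj u * (ρ * z)) := by
      linear_combination ρ * z * h2
    have h4 := one_sub_conj_mul_ne_zero hu1.le hρz
    simp only [h3, sub_zero, smul_eq_mul]
    field_simp
  rw [hcongr, hC, hderiv] at hA
  have e1 : ∀ θ, (ρ : ℂ) * circleMap 0 1 θ = circleMap 0 ρ θ := by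
    intro θ; simp [circleMap]
  have e2 : ∀ θ, conj (circleMap 0 1 θ) * (ρ * z) = conj (circleMap 0 ρ θ) * z := by
    intro θ; simp [circleMap]; ring
  simp only [e1, e2] at hA
  have hπ : (Real.pi : ℂ) ≠ 0 := by exact_mod_cast Real.pi_pos.ne'
  rw [hA, Complex.real_smul]
  push_cast
  rw [← mul_assoc, mul_inv_cancel₀ (mul_ne_zero two_ne_zero hπ), one_mul]

/-- The integrand is the derivative of `ρ^2 f(ρ^2 z)` in `ρ`. -/
theorem integral_two_mul_deriv_sq_mul {f : ℂ → ℂ}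
    (hf : DifferentiableOn ℂ f (Metric.ball 0 1)) {z : ℂ} (hz : ‖z‖ < 1) :
    ∫ ρ in (0 : ℝ)..1, 2 * (ρ : ℂ) * (f (ρ ^ 2 * z) + ρ ^ 2 * z * deriv f (ρ ^ 2 * z)) = f z := by
  have hmaps : Set.MapsTo (fun ρ : ℝ => (ρ : ℂ) ^ 2 * z) (Set.uIcc 0 1) (Metric.ball 0 1) := by
    intro ρ hρ
    rw [Set.uIcc_of_le zero_le_one] at hρ
    rw [mem_ball_zero_iff, norm_mul, norm_pow, Complex.norm_real, Real.norm_eq_abs,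
      abs_of_nonneg hρ.1]
    have : ρ ^ 2 ≤ 1 := pow_le_one₀ hρ.1 hρ.2
    nlinarith [norm_nonneg z]
  have hfd' : DifferentiableOn ℂ (deriv f) (Metric.ball 0 1) := hf.deriv Metric.isOpen_ball
  have hc : Continuous fun ρ : ℝ => (ρ : ℂ) ^ 2 * z := by fun_prop
  have hcf := hf.continuousOn.comp hc.continuousOn hmaps
  have hcf' := hfd'.continuousOn.comp hc.continuousOn hmaps
  have hcont : ContinuousOn (fun ρ : ℝ => 2 * (ρ : ℂ) *
      (f (ρ ^ 2 * z) + ρ ^ 2 * z * deriv f (ρ ^ 2 * z))) (Set.uIcc 0 1) :=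
    ContinuousOn.mul (Continuous.continuousOn (by fun_prop))
      (hcf.add (hc.continuousOn.mul hcf'))
  rw [intervalIntegral.integral_eq_sub_of_hasDerivAt
    (f := fun ρ : ℝ => (ρ : ℂ) ^ 2 * f (ρ ^ 2 * z)) ?_ hcont.intervalIntegrable]
  · simp
  intro ρ hρ
  have h1 : HasDerivAt f (deriv f (ρ ^ 2 * z)) (ρ ^ 2 * z) :=
    (hf.differentiableAt (Metric.isOpen_ball.mem_nhds (hmaps hρ))).hasDerivAt
  have h2 : HasDerivAt (fun ρ : ℂ => ρ ^ 2) (2 * (ρ : ℂ)) (ρ : ℂ) := by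
    simpa using hasDerivAt_pow 2 (ρ : ℂ)
  have h3 : HasDerivAt (fun u : ℂ => f (u ^ 2 * z)) (deriv f (ρ ^ 2 * z) * (2 * ρ * z)) (ρ : ℂ) :=
    HasDerivAt.comp (ρ : ℂ) (h₂ := f) (h := fun u : ℂ => u ^ 2 * z) h1 (h2.mul_const z)
  have h4 := (h2.fun_mul h3).comp_ofReal
  refine h4.congr_deriv ?_
  ring

/-- The reproducing formula of the Bergman kernel. -/
theorem integral_div_bergmanKernel_eq {f : ℂ → ℂ}
    (hf : DifferentiableOn ℂ f (Metric.ball 0 1))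
    (hfi : Integrable (fun ζ : Disc => f ζ) discMeasure) {z : ℂ} (hz : ‖z‖ < 1) :
    ∫ ζ : Disc, f ζ / (1 - conj (ζ : ℂ) * z) ^ 2 ∂discMeasure = f z := by
  set F : ℂ → ℂ := fun ζ => f ζ / (1 - conj ζ * z) ^ 2 with hF
  have hπ := Real.pi_pos
  have hFc : ContinuousOn F (Metric.ball 0 1) := by
    refine hf.continuousOn.div (by fun_prop) fun ζ hζ => pow_ne_zero _ ?_
    exact one_sub_conj_mul_ne_zero (mem_ball_zero_iff.1 hζ).le hz
  have hFi : Integrable (fun ζ : Disc => F ζ) discMeasure := Integrable.div_bergmanKernel hfi hz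
  -- Integrability is carried to polar coordinates through the formula for nonnegative functions;
  -- `f` need not be bounded near the circle.
  have hpolar : IntegrableOn (fun x : ℝ × ℝ => x.1 • F (circleMap 0 x.1 x.2))
      (Set.Ioo (0 : ℝ) 1 ×ˢ Set.Ioo (-Real.pi) Real.pi) := by
    have hm : MeasurableSet (Set.Ioo (0 : ℝ) 1 ×ˢ Set.Ioo (-Real.pi) Real.pi) :=
      measurableSet_Ioo.prod measurableSet_Ioo
    refine ⟨ContinuousOn.aestronglyMeasurable ?_ hm, ?_⟩
    · refine continuousOn_fst.smul (hFc.comp (Continuous.continuousOn ?_) fun x hx => ?_)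
      · unfold circleMap; fun_prop
      · have h1 : 0 < x.1 := hx.1.1
        have h2 : x.1 < 1 := hx.1.2
        simpa [abs_of_pos h1] using h2
    · have h1 := lintegral_ball_polar (fun ζ => ‖F ζ‖ₑ)
      have h2 := hFi.2
      rw [hasFiniteIntegral_iff_enorm, lintegral_discMeasure (fun ζ => ‖F ζ‖ₑ)] at h2
      have h3 : ∫⁻ ζ in Metric.ball (0 : ℂ) 1, ‖F ζ‖ₑ < ∞ := by
        rcases ENNReal.mul_lt_top_iff.1 h2 with h | h | h
        · exact h.2
        · simp at h
        · rw [h]; simp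
      rw [hasFiniteIntegral_iff_enorm]
      refine lt_of_eq_of_lt ?_ (h1 ▸ h3)
      refine setLIntegral_congr_fun hm fun x hx => ?_
      simp only [enorm_smul, Real.enorm_eq_ofReal hx.1.1.le]
  calc _ = (Real.pi⁻¹ : ℝ) • ∫ x in Set.Ioo (0 : ℝ) 1 ×ˢ Set.Ioo (-Real.pi) Real.pi,
        x.1 • F (circleMap 0 x.1 x.2) := by
        rw [← integral_ball_polar, ← integral_discMeasure]
    _ = (Real.pi⁻¹ : ℝ) • ∫ ρ in Set.Ioo (0 : ℝ) 1, ∫ θ in Set.Ioo (-Real.pi) Real.pi,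
        ρ • F (circleMap 0 ρ θ) := by
        rw [IntegrableOn, Measure.volume_eq_prod, ← Measure.prod_restrict] at hpolar
        rw [Measure.volume_eq_prod, ← Measure.prod_restrict, integral_prod _ hpolar]
    _ = (Real.pi⁻¹ : ℝ) • ∫ ρ in Set.Ioo (0 : ℝ) 1, (Real.pi : ℂ) *
        (2 * (ρ : ℂ) * (f (ρ ^ 2 * z) + ρ ^ 2 * z * deriv f (ρ ^ 2 * z))) := by
        congr 1
        refine setIntegral_congr_fun measurableSet_Ioo fun ρ hρ => ?_
        rw [integral_smul, integral_circleMap_div_bergmanKernel hf hz hρ.1 hρ.2,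
          Complex.real_smul]
        ring
    _ = f z := by
        rw [integral_const_mul, ← integral_Ioc_eq_integral_Ioo,
          ← intervalIntegral.integral_of_le zero_le_one, integral_two_mul_deriv_sq_mul hf hz,
          Complex.real_smul, ← mul_assoc, ← Complex.ofReal_mul, inv_mul_cancel₀ hπ.ne']
        simp

theorem DiscAnalytic.bergmanProjection_eq {f : Disc → ℂ} (hf : DiscAnalytic f)
    (hfi : Integrable f discMeasure) : bergmanProjection f = f := by
  obtain ⟨g, hg, hfg⟩ := hf
  obtain rfl : f = fun ζ : Disc => g ζ := funext hfg
  exact funext fun z => integral_div_bergmanKernel_eq hg hfi z.norm_lt_one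

theorem BergmanSpace.bergmanProjection_eq {p : ℝ} (hp : 1 < p) (f : BergmanSpace p) :
    bergmanProjection (f : Disc → ℂ) = f :=
  DiscAnalytic.bergmanProjection_eq f.2.1 (f.memLp.integrable_discMeasure hp)

/-! ### The duality map and Hölder's inequality -/

open Filter Topology

/-- The function `|w| ^ (p - 1) sgn w`. -/
noncomputable def powSgn (p : ℝ) (w : ℂ) : ℂ := ((‖w‖ ^ (p - 1) : ℝ) : ℂ) * complexSgn w

theorem norm_powSgn {p : ℝ} (hp : 1 < p) (w : ℂ) : ‖powSgn p w‖ = ‖w‖ ^ (p - 1) := by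
  rw [powSgn, norm_mul, Complex.norm_real, Real.norm_eq_abs, abs_of_nonneg (by positivity),
    complexSgn, norm_div, Complex.norm_real, norm_norm]
  rcases eq_or_ne w 0 with rfl | hw
  · simp [Real.zero_rpow (sub_pos.2 hp).ne']
  · rw [div_self (norm_ne_zero_iff.2 hw), mul_one]

/-- Together with `norm_powSgn_rpow` this is the equality case of Hölder: up to scaling, `|f|^(p-1)
sgn f` is the norming functional of `f`. -/
theorem mul_conj_powSgn {p : ℝ} (hp : 1 < p) (w : ℂ) :
    w * conj (powSgn p w) = ((‖w‖ ^ p : ℝ) : ℂ) := by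
  rcases eq_or_ne w 0 with rfl | hw
  · simp [Real.zero_rpow (zero_lt_one.trans hp).ne']
  have h0 : (‖w‖ : ℂ) ≠ 0 := by simpa using hw
  rw [powSgn, complexSgn, map_mul, Complex.conj_ofReal, map_div₀, Complex.conj_ofReal,
    Real.rpow_sub_one (norm_ne_zero_iff.2 hw)]
  have h1 : w * conj w = (‖w‖ : ℂ) ^ 2 := by
    rw [Complex.mul_conj, Complex.normSq_eq_norm_sq]; push_cast; rfl
  push_cast
  field_simp
  linear_combination ((‖w‖ ^ p : ℝ) : ℂ) * h1

/-- At `0` the sign jumps, but `|w|^(p-1)` tends to `0` because `p > 1`. -/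
theorem continuous_powSgn {p : ℝ} (hp : 1 < p) : Continuous (powSgn p) := by
  rw [continuous_iff_continuousAt]
  intro w
  rcases eq_or_ne w 0 with rfl | hw
  · have h0 : powSgn p 0 = 0 := by simp [powSgn, complexSgn]
    rw [ContinuousAt, h0, tendsto_zero_iff_norm_tendsto_zero]
    simp only [norm_powSgn hp]
    have h1 : ContinuousAt (fun w : ℂ => ‖w‖ ^ (p - 1)) 0 :=
      continuousAt_id.norm.rpow_const (Or.inr (by linarith))
    have h2 : ‖(0 : ℂ)‖ ^ (p - 1) = 0 := by
      rw [norm_zero, Real.zero_rpow (by linarith)]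
    simpa only [ContinuousAt, h2] using h1
  · unfold powSgn complexSgn
    have h1 : ContinuousAt (fun w : ℂ => ‖w‖ ^ (p - 1)) w :=
      continuousAt_id.norm.rpow_const (Or.inr (by linarith))
    exact (Complex.continuous_ofReal.continuousAt.comp h1).mul
      (continuousAt_id.div (Complex.continuous_ofReal.comp continuous_norm).continuousAt
        (by simpa using hw))

section Holder

variable {α : Type*} [MeasurableSpace α] {μ : Measure α} {p q : ℝ}

theorem integrable_norm_rpow_iff_memLp_ofReal (hp : 0 < p) {f : α → ℂ}
    (hf : AEStronglyMeasurable f μ) :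
    Integrable (fun x => ‖f x‖ ^ p) μ ↔ MemLp f (ENNReal.ofReal p) μ := by
  simpa [ENNReal.toReal_ofReal hp.le] using
    integrable_norm_rpow_iff hf (p := ENNReal.ofReal p) (by simpa using hp) ENNReal.ofReal_ne_top

theorem norm_powSgn_rpow (hpq : p.HolderConjugate q) (w : ℂ) :
    ‖powSgn p w‖ ^ q = ‖w‖ ^ p := by
  rw [norm_powSgn hpq.lt, ← Real.rpow_mul (norm_nonneg _), hpq.sub_one_mul_conj]

theorem MeasureTheory.MemLp.powSgn (hpq : p.HolderConjugate q) {f : α → ℂ}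
    (hf : MemLp f (ENNReal.ofReal p) μ) :
    MemLp (fun x => powSgn p (f x)) (ENNReal.ofReal q) μ := by
  have hm := (continuous_powSgn hpq.lt).comp_aestronglyMeasurable hf.1
  rw [← integrable_norm_rpow_iff_memLp_ofReal hpq.symm.pos hm]
  simpa only [norm_powSgn_rpow hpq] using
    (integrable_norm_rpow_iff_memLp_ofReal hpq.pos hf.1).2 hf

theorem integrable_mul_conj (hpq : p.HolderConjugate q) {f g : α → ℂ}
    (hf : MemLp f (ENNReal.ofReal p) μ) (hg : MemLp g (ENNReal.ofReal q) μ) :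
    Integrable (fun x => f x * conj (g x)) μ := by
  have h : ENNReal.HolderTriple (ENNReal.ofReal p) (ENNReal.ofReal q) 1 := by
    simpa using Real.HolderTriple.ennrealOfReal hpq
  exact hf.integrable_mul (hg.star)

theorem norm_integral_mul_conj_le (hpq : p.HolderConjugate q) {f g : α → ℂ}
    (hf : MemLp f (ENNReal.ofReal p) μ) (hg : MemLp g (ENNReal.ofReal q) μ) :
    ‖∫ x, f x * conj (g x) ∂μ‖ ≤
      (∫ x, ‖f x‖ ^ p ∂μ) ^ (1 / p) * (∫ x, ‖g x‖ ^ q ∂μ) ^ (1 / q) := by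
  refine (norm_integral_le_integral_norm _).trans ?_
  simpa only [norm_mul, RCLike.norm_conj] using integral_mul_norm_le_Lp_mul_Lq hpq hf hg

theorem integral_mul_conj_powSgn (hp : 1 < p) (f : α → ℂ) :
    ∫ x, f x * conj (powSgn p (f x)) ∂μ = ((∫ x, ‖f x‖ ^ p ∂μ : ℝ) : ℂ) := by
  simp only [mul_conj_powSgn hp]
  exact integral_complex_ofReal

end Holder

/-! ### Monomials and power series in the Bergman space -/

namespace BergmanSpace

variable {p : ℝ}

theorem ext {f g : BergmanSpace p} (h : ∀ z, f z = g z) : f = g := Subtype.ext (funext h)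

/-- Evaluation at a point of the disc. -/
def eval (z : Disc) : BergmanSpace p →ₗ[ℂ] ℂ where
  toFun f := f z
  map_add' _ _ := rfl
  map_smul' _ _ := rfl

theorem eval_apply (z : Disc) (f : BergmanSpace p) : eval z f = f z := rfl

/-- A bounded analytic function, as an element of `A ^ p`. -/
def ofBounded (p : ℝ) (f : Disc → ℂ) (hf : DiscAnalytic f) (C : ℝ) (hC : ∀ z, ‖f z‖ ≤ C) :
    BergmanSpace p :=
  ⟨f, hf, MemLp.of_bound hf.continuous.aestronglyMeasurable C (Eventually.of_forall hC)⟩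

/-- The monomial `z ^ n`. -/
def monomial (p : ℝ) (n : ℕ) : BergmanSpace p :=
  ofBounded p (fun z => (z : ℂ) ^ n) ⟨fun z => z ^ n, by fun_prop, fun _ => rfl⟩ 1 fun z => by
    rw [norm_pow]; exact pow_le_one₀ (norm_nonneg _) z.norm_lt_one.le

theorem monomial_apply (n : ℕ) (z : Disc) : monomial p n z = (z : ℂ) ^ n := rfl

variable [hp : Fact (1 < p)]

theorem norm_le_of_forall_le (f : BergmanSpace p) {C : ℝ} (hC : 0 ≤ C) (h : ∀ z, ‖f z‖ ≤ C) :
    ‖f‖ ≤ C := by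
  have h1 : ‖f‖ = (eLpNorm (f : Disc → ℂ) (ENNReal.ofReal p) discMeasure).toReal :=
    Lp.norm_toLp _ f.memLp
  rw [h1]
  refine ENNReal.toReal_le_of_le_ofReal hC ?_
  simpa using eLpNorm_le_of_ae_bound (p := ENNReal.ofReal p) (μ := discMeasure)
    (Eventually.of_forall h)

theorem norm_rpow_eq (f : BergmanSpace p) : ‖f‖ ^ p = ∫ z, ‖f z‖ ^ p ∂discMeasure := by
  have h0 : 0 < p := one_pos.trans hp.out
  rw [norm_eq, ← Real.rpow_mul (integral_nonneg fun z => by positivity),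
    one_div_mul_cancel h0.ne', Real.rpow_one]

theorem norm_monomial_le (n : ℕ) : ‖monomial p n‖ ≤ 1 :=
  norm_le_of_forall_le _ zero_le_one fun z => by
    rw [monomial_apply, norm_pow]; exact pow_le_one₀ (norm_nonneg _) z.norm_lt_one.le

/-- The partial sums converge uniformly on the disc, and for a probability measure the supremum
dominates the `A^p` norm. Convergence in norm lets a functional act term by term. -/
theorem hasSum_smul_monomial {b : ℕ → ℂ} (hb : Summable fun n => ‖b n‖) (f : BergmanSpace p)
    (hf : ∀ z : Disc, f z = ∑' n, b n * (z : ℂ) ^ n) :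
    HasSum (fun n => b n • monomial p n) f := by
  have hu := tendstoUniformly_tsum (f := fun n (z : Disc) => b n * (z : ℂ) ^ n) hb fun n z => by
    rw [norm_mul, norm_pow]
    exact mul_le_of_le_one_right (norm_nonneg _)
      (pow_le_one₀ (norm_nonneg _) z.norm_lt_one.le)
  rw [Metric.tendstoUniformly_iff] at hu
  rw [HasSum, SummationFilter.unconditional_filter, Metric.tendsto_nhds]
  intro ε hε
  filter_upwards [hu (ε / 2) (by positivity)] with t ht
  refine lt_of_le_of_lt ?_ (half_lt_self hε)
  rw [dist_comm, dist_eq_norm]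
  refine norm_le_of_forall_le _ (by positivity) fun z => ?_
  have h1 : eval z (f - ∑ n ∈ t, b n • monomial p n) =
      f z - ∑ n ∈ t, b n * (z : ℂ) ^ n := by
    rw [map_sub, map_sum]
    simp only [map_smul, eval_apply, monomial_apply, smul_eq_mul]
  rw [← eval_apply, h1, hf z, ← dist_eq_norm]
  exact (ht z).le

end BergmanSpace

theorem summable_natCast_add_one_mul_pow {r : ℝ} (h0 : 0 ≤ r) (h1 : r < 1) :
    Summable fun n : ℕ => ((n : ℝ) + 1) * r ^ n := by
  have := (hasSum_choose_mul_geometric_of_norm_lt_one 1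
    (show ‖r‖ < 1 by rwa [Real.norm_of_nonneg h0])).summable
  simpa using this

theorem tsum_natCast_add_one_mul_pow {w : ℂ} (hw : ‖w‖ < 1) :
    ∑' n : ℕ, ((n : ℂ) + 1) * w ^ n = 1 / (1 - w) ^ 2 := by
  simpa using tsum_choose_mul_geometric_of_norm_lt_one 1 hw

theorem discAnalytic_tsum {d : ℕ → ℂ} {C : ℝ} (hd : ∀ n, ‖d n‖ ≤ C * (n + 1)) :
    DiscAnalytic fun z => ∑' n, d n * (z : ℂ) ^ n := by
  refine ⟨fun z => ∑' n, d n * z ^ n, fun z hz => ?_, fun _ => rfl⟩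
  have hz1 : ‖z‖ < 1 := mem_ball_zero_iff.1 hz
  obtain ⟨r, hr, hr1⟩ := exists_between hz1
  have hr0 : 0 ≤ r := (norm_nonneg z).trans hr.le
  have h := Complex.differentiableOn_tsum_of_summable_norm (F := fun n (z : ℂ) => d n * z ^ n)
    ((summable_natCast_add_one_mul_pow hr0 hr1).mul_left C) (fun n => by fun_prop)
    (Metric.isOpen_ball (x := (0 : ℂ)) (ε := r)) fun n w hw => by
      rw [norm_mul, norm_pow, ← mul_assoc]
      have : ‖w‖ ≤ r := (mem_ball_zero_iff.1 hw).le
      exact mul_le_mul (hd n) (by gcongr) (by positivity) ((norm_nonneg _).trans (hd n))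
  exact (h.differentiableAt
    (Metric.isOpen_ball.mem_nhds (by simpa using hr))).differentiableWithinAt

/-- The closed disc of radius `r` in the unit disc. -/
def closedSubdisc (r : ℝ) : Set Disc := {z | ‖(z : ℂ)‖ ≤ r}

theorem measurableSet_closedSubdisc (r : ℝ) : MeasurableSet (closedSubdisc r) :=
  (isClosed_le (by fun_prop) continuous_const).measurableSet

theorem isCompact_closedSubdisc {r : ℝ} (hr : r < 1) : IsCompact (closedSubdisc r) := by
  rw [Subtype.isCompact_iff]
  have : Subtype.val '' closedSubdisc r = Metric.closedBall (0 : ℂ) r := by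
    ext z
    constructor
    · rintro ⟨w, hw, rfl⟩
      exact mem_closedBall_zero_iff.2 hw
    · intro hz
      have h1 := mem_closedBall_zero_iff.1 hz
      exact ⟨⟨z, mem_ball_zero_iff.2 (h1.trans_lt hr)⟩, h1, rfl⟩
  rw [this]
  exact isCompact_closedBall _ _

theorem integrable_mul_conj_pow {g : Disc → ℂ} (hg : Integrable g discMeasure) (n : ℕ) :
    Integrable (fun ζ => g ζ * conj (ζ : ℂ) ^ n) discMeasure := by
  refine hg.mul_bdd (c := 1) (Continuous.aestronglyMeasurable (by fun_prop))
    (Eventually.of_forall fun ζ => ?_)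
  rw [norm_pow, RCLike.norm_conj]
  exact pow_le_one₀ (norm_nonneg _) ζ.norm_lt_one.le

/-- Support in the disc of radius `r < 1` gives the geometric decay that beats the coefficients `n +
1` of the Bergman kernel. -/
theorem norm_integral_mul_conj_pow_le {g : Disc → ℂ} (hg : Integrable g discMeasure) {r : ℝ}
    (hgr : ∀ ζ ∉ closedSubdisc r, g ζ = 0) (n : ℕ) :
    ∫ ζ, ‖g ζ * conj (ζ : ℂ) ^ n‖ ∂discMeasure ≤ r ^ n * ∫ ζ, ‖g ζ‖ ∂discMeasure := by
  rw [← integral_const_mul]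
  refine integral_mono (integrable_mul_conj_pow hg n).norm (hg.norm.const_mul _) fun ζ => ?_
  simp only [norm_mul, norm_pow, RCLike.norm_conj]
  by_cases h : ζ ∈ closedSubdisc r
  · have h' : ‖(ζ : ℂ)‖ ≤ r := h
    rw [mul_comm]
    gcongr
  · simp [hgr ζ h]

/-- Used with `d n = (n+1) z^n`, which yields the Bergman projection, and with `d n = (n+1) φ(z^n)`,
which yields the pairing with the candidate kernel. -/
theorem hasSum_integral_mul_tsum {g : Disc → ℂ} (hg : Integrable g discMeasure) {r : ℝ}
    (hr0 : 0 ≤ r) (hr1 : r < 1) (hgr : ∀ ζ ∉ closedSubdisc r, g ζ = 0) {d : ℕ → ℂ} {C : ℝ}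
    (hd : ∀ n, ‖d n‖ ≤ C * (n + 1)) :
    HasSum (fun n => d n * ∫ ζ, g ζ * conj (ζ : ℂ) ^ n ∂discMeasure)
      (∫ ζ, g ζ * ∑' n, d n * conj (ζ : ℂ) ^ n ∂discMeasure) := by
  have h := hasSum_integral_of_summable_integral_norm (μ := discMeasure)
    (F := fun n (ζ : Disc) => d n * (g ζ * conj (ζ : ℂ) ^ n))
    (fun n => (integrable_mul_conj_pow hg n).const_mul _) ?_
  · have e (ζ : Disc) : ∑' n, d n * (g ζ * conj (ζ : ℂ) ^ n) =
        g ζ * ∑' n, d n * conj (ζ : ℂ) ^ n := by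
      rw [← tsum_mul_left]
      exact tsum_congr fun n => by ring
    simpa only [integral_const_mul, e] using h
  · refine Summable.of_nonneg_of_le (fun n => integral_nonneg fun ζ => norm_nonneg _) (fun n => ?_)
      (((summable_natCast_add_one_mul_pow hr0 hr1).mul_left C).mul_right
        (∫ ζ, ‖g ζ‖ ∂discMeasure))
    simp only [norm_mul (d n)]
    rw [integral_const_mul, ← mul_assoc, mul_assoc (C * _)]
    exact mul_le_mul (hd n) (norm_integral_mul_conj_pow_le hg hgr n)
      (integral_nonneg fun ζ => norm_nonneg _) ((norm_nonneg _).trans (hd n))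

theorem bergmanProjection_eq_tsum {g : Disc → ℂ} (hg : Integrable g discMeasure) {r : ℝ}
    (hr0 : 0 ≤ r) (hr1 : r < 1) (hgr : ∀ ζ ∉ closedSubdisc r, g ζ = 0) (z : Disc) :
    bergmanProjection g z =
      ∑' n : ℕ, (((n : ℂ) + 1) * ∫ ζ, g ζ * conj (ζ : ℂ) ^ n ∂discMeasure) * (z : ℂ) ^ n := by
  have h := (hasSum_integral_mul_tsum hg hr0 hr1 hgr (d := fun n => ((n : ℂ) + 1) * (z : ℂ) ^ n)
    (C := 1) fun n => ?_).tsum_eq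
  · have e1 : ∀ ζ : Disc, g ζ * ∑' n : ℕ, ((n : ℂ) + 1) * (z : ℂ) ^ n * conj (ζ : ℂ) ^ n =
        g ζ / (1 - conj (ζ : ℂ) * z) ^ 2 := by
      intro ζ
      have hw : ‖conj (ζ : ℂ) * z‖ < 1 := by
        rw [norm_mul, RCLike.norm_conj]
        nlinarith [ζ.norm_lt_one, z.norm_lt_one, norm_nonneg (ζ : ℂ), norm_nonneg (z : ℂ)]
      rw [div_eq_mul_one_div, ← tsum_natCast_add_one_mul_pow hw]
      congr 2; ext n; rw [mul_pow]; ring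
    simp only [e1] at h
    rw [bergmanProjection, ← h]
    congr 1; ext n; ring
  · rw [norm_mul, norm_pow, one_mul]
    have h1 : ‖(n : ℂ) + 1‖ = n + 1 := by
      rw [← Nat.cast_add_one, Complex.norm_natCast]; push_cast; rfl
    rw [h1]
    exact mul_le_of_le_one_right (by positivity)
      (pow_le_one₀ (norm_nonneg _) z.norm_lt_one.le)

/-- Divide by `I^(1/p)`. This is legitimate only for finite `I`, so it is applied to integrals over
compact subdiscs. -/
theorem le_rpow_of_le_mul_rpow {p q : ℝ} (hpq : p.HolderConjugate q) {I M : ℝ} (hI : 0 ≤ I) (hM : 0 ≤ M)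
    (h : I ≤ M * I ^ (1 / p)) : I ≤ M ^ q := by
  have hq := hpq.symm.pos
  rcases hI.eq_or_lt with rfl | hI
  · positivity
  have h1 : I = I ^ (1 / q) * I ^ (1 / p) := by
    rw [← Real.rpow_add hI, one_div, one_div, add_comm, hpq.inv_add_inv_eq_one, Real.rpow_one]
  have h2 : I ^ (1 / q) ≤ M := by
    refine le_of_mul_le_mul_right ?_ (Real.rpow_pos_of_pos hI (1 / p))
    rwa [← h1]
  calc I = (I ^ (1 / q)) ^ q := by
        rw [← Real.rpow_mul hI.le, one_div_mul_cancel hq.ne', Real.rpow_one]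
    _ ≤ M ^ q := by gcongr

/-- The exhaustion of the disc by the closed discs of radius `n / (n + 1)`. -/
def discExhaustion (n : ℕ) : Set Disc := closedSubdisc (n / (n + 1))

theorem discExhaustion_mono : Monotone discExhaustion := by
  intro m n hmn z hz
  have h1 : (m : ℝ) ≤ n := by exact_mod_cast hmn
  refine le_trans (show ‖(z : ℂ)‖ ≤ m / (m + 1) from hz) ?_
  rw [div_le_div_iff₀ (by positivity) (by positivity)]
  linarith

theorem eventually_mem_discExhaustion (z : Disc) : ∀ᶠ n in atTop, z ∈ discExhaustion n :=
  (tendsto_natCast_div_add_atTop (1 : ℝ)).eventually (eventually_ge_nhds z.norm_lt_one)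

theorem radius_discExhaustion (n : ℕ) : 0 ≤ (n : ℝ) / (n + 1) ∧ (n : ℝ) / (n + 1) < 1 :=
  ⟨by positivity, by rw [div_lt_one (by positivity)]; linarith⟩

theorem bergmanProjection_sub {f g : Disc → ℂ} (hf : Integrable f discMeasure)
    (hg : Integrable g discMeasure) (z : Disc) :
    bergmanProjection (f - g) z = bergmanProjection f z - bergmanProjection g z := by
  rw [bergmanProjection, bergmanProjection, bergmanProjection,
    ← integral_sub (Integrable.div_bergmanKernel hf z.norm_lt_one)
      (Integrable.div_bergmanKernel hg z.norm_lt_one)]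
  simp only [Pi.sub_apply, sub_div]

theorem tendsto_integral_norm_sub_indicator {p q : ℝ} (hpq : p.HolderConjugate q) {f : Disc → ℂ}
    (hf : MemLp f (ENNReal.ofReal p) discMeasure) :
    Tendsto (fun n => ∫ z, ‖(f - (discExhaustion n).indicator f) z‖ ^ p ∂discMeasure) atTop
      (𝓝 0) := by
  have hm : ∀ n, MeasurableSet (discExhaustion n) := fun n => measurableSet_closedSubdisc _
  rw [show (0 : ℝ) = ∫ z : Disc, (0 : ℝ) ∂discMeasure by simp]
  refine tendsto_integral_of_dominated_convergence (fun z => ‖f z‖ ^ p) (fun n => ?_)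
    ((integrable_norm_rpow_iff_memLp_ofReal hpq.pos hf.1).2 hf) (fun n => ?_) ?_
  · exact ((hf.1.sub (hf.1.indicator (hm n))).norm.aemeasurable.pow_const p).aestronglyMeasurable
  · refine Eventually.of_forall fun z => ?_
    rw [Real.norm_of_nonneg (by positivity)]
    refine Real.rpow_le_rpow (norm_nonneg _) ?_ hpq.nonneg
    by_cases h : z ∈ discExhaustion n <;> simp [h]
  · refine Eventually.of_forall fun z => tendsto_const_nhds.congr' ?_
    filter_upwards [eventually_mem_discExhaustion z] with n hn
    simp [hn, Real.zero_rpow hpq.pos.ne']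

theorem tendsto_integral_indicator_mul {f g : Disc → ℂ}
    (hfg : Integrable (fun z => f z * g z) discMeasure) :
    Tendsto (fun n => ∫ z, (discExhaustion n).indicator f z * g z ∂discMeasure) atTop
      (𝓝 (∫ z, f z * g z ∂discMeasure)) := by
  have e : ∀ n z, (discExhaustion n).indicator f z * g z =
      (discExhaustion n).indicator (fun z => f z * g z) z := by
    intro n z
    by_cases h : z ∈ discExhaustion n <;> simp [h]
  simp only [e]
  refine tendsto_integral_of_dominated_convergence (fun z => ‖f z * g z‖)
    (fun n => hfg.1.indicator (measurableSet_closedSubdisc _)) hfg.norm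
    (fun n => Eventually.of_forall fun z => norm_indicator_le_norm_self _ _)
    (Eventually.of_forall fun z => tendsto_const_nhds.congr' ?_)
  filter_upwards [eventually_mem_discExhaustion z] with n hn
  simp [hn]

/-! ### Existence and uniqueness of kernels -/

/-- The candidate for the kernel of a functional, given by its Taylor series. -/
noncomputable def kernelSeries {p : ℝ} [Fact (1 < p)] (φ : StrongDual ℂ (BergmanSpace p))
    (z : Disc) : ℂ :=
  ∑' n : ℕ, (((n : ℂ) + 1) * conj (φ (BergmanSpace.monomial p n))) * (z : ℂ) ^ n

section

variable {p q : ℝ} [hp : Fact (1 < p)] (φ : StrongDual ℂ (BergmanSpace p))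

theorem norm_natCast_add_one_mul_monomial_le (n : ℕ) :
    ‖((n : ℂ) + 1) * φ (BergmanSpace.monomial p n)‖ ≤ ‖φ‖ * (n + 1) := by
  have h1 : ‖(n : ℂ) + 1‖ = n + 1 := by
    rw [← Nat.cast_add_one, Complex.norm_natCast]; push_cast; rfl
  rw [norm_mul, h1, mul_comm]
  gcongr
  exact (φ.le_opNorm _).trans
    (mul_le_of_le_one_right (norm_nonneg _) (BergmanSpace.norm_monomial_le n))

theorem discAnalytic_kernelSeries : DiscAnalytic (kernelSeries φ) := by
  refine discAnalytic_tsum (C := ‖φ‖) fun n => ?_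
  simpa only [norm_mul, RCLike.norm_conj] using norm_natCast_add_one_mul_monomial_le φ n

theorem conj_kernelSeries (z : Disc) :
    conj (kernelSeries φ z) =
      ∑' n : ℕ, (((n : ℂ) + 1) * φ (BergmanSpace.monomial p n)) * conj (z : ℂ) ^ n := by
  rw [kernelSeries, Complex.conj_tsum]
  simp

/-- The Taylor coefficients `(n+1) ∫ g conj(ζ)^n` of `P g` are absolutely summable, so `φ` passes
through the series; integrating `g` against the conjugate of `kernelSeries φ` gives the same sum. -/
theorem apply_bergmanProj_eq_integral (hpq : p.HolderConjugate q) {g : Disc → ℂ}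
    (hg : MemLp g (ENNReal.ofReal p) discMeasure) {r : ℝ} (hr0 : 0 ≤ r) (hr1 : r < 1)
    (hgr : ∀ ζ ∉ closedSubdisc r, g ζ = 0) :
    φ (bergmanProj hpq g hg) = ∫ ζ, g ζ * conj (kernelSeries φ ζ) ∂discMeasure := by
  have hgi := hg.integrable_discMeasure hpq.lt
  have h1 := hasSum_integral_mul_tsum hgi hr0 hr1 hgr (norm_natCast_add_one_mul_monomial_le φ)
  simp only [← conj_kernelSeries] at h1
  refine HasSum.unique ?_ h1
  have hb : Summable fun n : ℕ =>
      ‖((n : ℂ) + 1) * ∫ ζ, g ζ * conj (ζ : ℂ) ^ n ∂discMeasure‖ := by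
    refine Summable.of_nonneg_of_le (fun n => norm_nonneg _) (fun n => ?_)
      ((summable_natCast_add_one_mul_pow hr0 hr1).mul_right (∫ ζ, ‖g ζ‖ ∂discMeasure))
    have h1 : ‖(n : ℂ) + 1‖ = n + 1 := by
      rw [← Nat.cast_add_one, Complex.norm_natCast]; push_cast; rfl
    rw [norm_mul, h1, mul_assoc]
    gcongr
    exact (norm_integral_le_integral_norm _).trans (norm_integral_mul_conj_pow_le hgi hgr n)
  have h2 := (BergmanSpace.hasSum_smul_monomial hb (bergmanProj hpq g hg)
    (bergmanProjection_eq_tsum hgi hr0 hr1 hgr)).mapL φ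
  have e (n : ℕ) : φ ((((n : ℂ) + 1) * ∫ ζ, g ζ * conj (ζ : ℂ) ^ n ∂discMeasure) •
      BergmanSpace.monomial p n) = (((n : ℂ) + 1) * φ (BergmanSpace.monomial p n)) *
        ∫ ζ, g ζ * conj (ζ : ℂ) ^ n ∂discMeasure := by
    rw [map_smul, smul_eq_mul]
    ring
  simpa only [e] using h2

theorem exists_norm_bergmanProj_le (hpq : p.HolderConjugate q) :
    ∃ M : ℝ, 0 ≤ M ∧ ∀ (g : Disc → ℂ) (hg : MemLp g (ENNReal.ofReal p) discMeasure),
      ‖bergmanProj hpq g hg‖ ≤ M * (∫ z, ‖g z‖ ^ p ∂discMeasure) ^ (1 / p) := by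
  obtain ⟨C, hC, h⟩ := exists_eLpNorm_bergmanProjection_le hpq
  refine ⟨C.toReal, ENNReal.toReal_nonneg, fun g hg => ?_⟩
  have h1 : ‖bergmanProj hpq g hg‖ =
      (eLpNorm (bergmanProjection g) (ENNReal.ofReal p) discMeasure).toReal :=
    Lp.norm_toLp _ (memLp_bergmanProjection hpq hg)
  have h2 := ENNReal.toReal_mono (ENNReal.mul_ne_top hC hg.2.ne) (h g hg)
  rwa [← h1, ENNReal.toReal_mul, hg.eLpNorm_eq_integral_rpow_norm (by simpa using hpq.pos)
    ENNReal.ofReal_ne_top, ENNReal.toReal_ofReal hpq.nonneg, ENNReal.toReal_ofReal (by positivity),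
    ← one_div] at h2

/-- Take `g = |k|^(q-1) sgn k` on the subdisc and `0` outside, and let `I` be the integral to be
bounded. Then `φ(P g) = I` and `g` has `L^p` norm `I^(1/p)`, so `I ≤ ‖φ‖ M I^(1/p)`, where `M`
bounds `P` independently of `r`. -/
theorem exists_setIntegral_kernelSeries_le (hpq : p.HolderConjugate q) :
    ∃ B : ℝ, ∀ r, 0 ≤ r → r < 1 →
      ∫ ζ in closedSubdisc r, ‖kernelSeries φ ζ‖ ^ q ∂discMeasure ≤ B := by
  obtain ⟨M, hM, h⟩ := exists_norm_bergmanProj_le hpq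
  refine ⟨(‖φ‖ * M) ^ q, fun r hr0 hr1 => ?_⟩
  set k := kernelSeries φ
  have hk : Continuous k := (discAnalytic_kernelSeries φ).continuous
  have hkq : Continuous fun ζ => powSgn q (k ζ) := (continuous_powSgn hpq.symm.lt).comp hk
  set S := closedSubdisc r
  have hS : MeasurableSet S := measurableSet_closedSubdisc r
  obtain ⟨B, hB⟩ := (isCompact_closedSubdisc hr1).exists_bound_of_continuousOn hkq.continuousOn
  set g : Disc → ℂ := S.indicator fun ζ => powSgn q (k ζ) with hgdef
  have hg : MemLp g (ENNReal.ofReal p) discMeasure := by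
    refine MemLp.of_bound (hkq.aestronglyMeasurable.indicator hS) (max B 0)
      (Eventually.of_forall fun ζ => ?_)
    by_cases hζ : ζ ∈ S
    · rw [hgdef, Set.indicator_of_mem hζ]; exact (hB ζ hζ).trans (le_max_left _ _)
    · rw [hgdef, Set.indicator_of_notMem hζ, norm_zero]; exact le_max_right _ _
  have h1 : φ (bergmanProj hpq g hg) = ∫ ζ, g ζ * conj (k ζ) ∂discMeasure :=
    apply_bergmanProj_eq_integral φ hpq hg hr0 hr1 fun ζ hζ => Set.indicator_of_notMem hζ _
  have e1 : ∀ ζ, g ζ * conj (k ζ) = S.indicator (fun ζ => ((‖k ζ‖ ^ q : ℝ) : ℂ)) ζ := by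
    intro ζ
    by_cases hζ : ζ ∈ S
    · rw [hgdef, Set.indicator_of_mem hζ, Set.indicator_of_mem hζ]
      have := congrArg conj (mul_conj_powSgn hpq.symm.lt (k ζ))
      rw [map_mul, Complex.conj_conj, Complex.conj_ofReal] at this
      rw [← this, mul_comm]
    · rw [hgdef, Set.indicator_of_notMem hζ, Set.indicator_of_notMem hζ, zero_mul]
  have e2 : ∀ ζ, ‖g ζ‖ ^ p = S.indicator (fun ζ => ‖k ζ‖ ^ q) ζ := by
    intro ζ
    by_cases hζ : ζ ∈ S
    · rw [hgdef, Set.indicator_of_mem hζ, Set.indicator_of_mem hζ, norm_powSgn_rpow hpq.symm]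
    · rw [hgdef, Set.indicator_of_notMem hζ, Set.indicator_of_notMem hζ, norm_zero,
        Real.zero_rpow hpq.pos.ne']
  have h2 := h g hg
  simp only [e1] at h1
  simp only [e2] at h2
  rw [integral_indicator hS, integral_complex_ofReal] at h1
  rw [integral_indicator hS] at h2
  have hI : 0 ≤ ∫ ζ in S, ‖k ζ‖ ^ q ∂discMeasure := integral_nonneg fun ζ => by positivity
  refine le_rpow_of_le_mul_rpow hpq hI (by positivity) ?_
  calc ∫ ζ in S, ‖k ζ‖ ^ q ∂discMeasure = ‖φ (bergmanProj hpq g hg)‖ := by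
        rw [h1, Complex.norm_real, Real.norm_of_nonneg hI]
    _ ≤ ‖φ‖ * ‖bergmanProj hpq g hg‖ := φ.le_opNorm _
    _ ≤ _ := by rw [mul_assoc]; gcongr

theorem memLp_kernelSeries (hpq : p.HolderConjugate q) :
    MemLp (kernelSeries φ) (ENNReal.ofReal q) discMeasure := by
  have hk : Continuous (kernelSeries φ) := (discAnalytic_kernelSeries φ).continuous
  have hkq : Continuous fun ζ => ‖kernelSeries φ ζ‖ ^ q :=
    hk.norm.rpow_const fun _ => Or.inr hpq.symm.nonneg
  rw [← integrable_norm_rpow_iff_memLp_ofReal hpq.symm.pos hk.aestronglyMeasurable]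
  obtain ⟨B, hB⟩ := exists_setIntegral_kernelSeries_le φ hpq
  refine ⟨hkq.aestronglyMeasurable, ?_⟩
  rw [hasFiniteIntegral_iff_ofReal (Eventually.of_forall fun ζ => by positivity)]
  have hU : ⋃ n, discExhaustion n = Set.univ := Set.eq_univ_of_forall fun z =>
    Set.mem_iUnion.2 (eventually_mem_discExhaustion z).exists
  rw [← setLIntegral_univ, ← hU,
    setLIntegral_iUnion_of_directed _ discExhaustion_mono.directed_le]
  refine lt_of_le_of_lt (iSup_le fun n => ?_) (ENNReal.ofReal_lt_top (r := B))
  obtain ⟨h0, h1⟩ := radius_discExhaustion n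
  rw [discExhaustion, ← ofReal_integral_eq_lintegral_ofReal
    (hkq.continuousOn.integrableOn_compact (isCompact_closedSubdisc h1))
    (Eventually.of_forall fun ζ => by positivity)]
  exact ENNReal.ofReal_le_ofReal (hB _ h0 h1)

/-- The truncations of `f` to the exhausting discs satisfy the identity, and their projections tend
to `P f = f` in `A^p` since `P` is bounded; the integrals converge by dominated convergence. -/
theorem isKernel_kernelSeries (hpq : p.HolderConjugate q) :
    IsKernel φ (⟨kernelSeries φ, discAnalytic_kernelSeries φ, memLp_kernelSeries φ hpq⟩ :
      BergmanSpace q) := by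
  intro f
  obtain ⟨M, hM, h⟩ := exists_norm_bergmanProj_le hpq
  have hm : ∀ n, MeasurableSet (discExhaustion n) := fun n => measurableSet_closedSubdisc _
  have hfn : ∀ n, MemLp ((discExhaustion n).indicator f) (ENNReal.ofReal p) discMeasure :=
    fun n => f.memLp.indicator (hm n)
  have h1 : ∀ n, φ (bergmanProj hpq _ (hfn n)) =
      ∫ ζ, (discExhaustion n).indicator f ζ * conj (kernelSeries φ ζ) ∂discMeasure := fun n =>
    apply_bergmanProj_eq_integral φ hpq (hfn n) (radius_discExhaustion n).1
      (radius_discExhaustion n).2 fun ζ hζ => Set.indicator_of_notMem hζ _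
  have h2 : Tendsto (fun n => bergmanProj hpq _ (hfn n)) atTop (𝓝 f) := by
    rw [tendsto_iff_norm_sub_tendsto_zero]
    have h3 := ((tendsto_integral_norm_sub_indicator hpq f.memLp).rpow_const
      (p := 1 / p) (Or.inr (by have := hpq.pos; positivity))).const_mul M
    rw [Real.zero_rpow (by have := hpq.pos; positivity), mul_zero] at h3
    refine squeeze_zero (fun n => norm_nonneg _) (fun n => ?_) h3
    refine le_trans (le_of_eq ?_) (h _ (f.memLp.sub (hfn n)))
    rw [norm_sub_rev]
    congr 1
    refine BergmanSpace.ext fun z => ?_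
    have h4 := bergmanProjection_sub (f.memLp.integrable_discMeasure hpq.lt)
      ((hfn n).integrable_discMeasure hpq.lt) z
    rw [BergmanSpace.bergmanProjection_eq hpq.lt] at h4
    exact h4.symm
  have h3 := (φ.continuous.tendsto f).comp h2
  simp only [Function.comp_def, h1] at h3
  exact tendsto_nhds_unique h3
    (tendsto_integral_indicator_mul (integrable_mul_conj hpq f.memLp (memLp_kernelSeries φ hpq)))

/-- The Bergman kernel function at a point of the disc. -/
noncomputable def bergmanKernel (p : ℝ) (w : Disc) : BergmanSpace p :=
  .ofBounded p (fun z => 1 / (1 - conj (w : ℂ) * z) ^ 2)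
    ⟨fun z => 1 / (1 - conj (w : ℂ) * z) ^ 2, fun z hz => by
      have := bergmanKernel_ne_zero w (mem_ball_zero_iff.1 hz)
      exact (DifferentiableAt.fun_div (𝕜 := ℂ) (by fun_prop) (by fun_prop)
        this).differentiableWithinAt,
      fun _ => rfl⟩ (1 / (1 - ‖(w : ℂ)‖) ^ 2) fun z => by
    have h1 := w.norm_lt_one
    have h2 : 1 - ‖(w : ℂ)‖ ≤ ‖1 - conj (w : ℂ) * z‖ := by
      have h3 : ‖1 - conj (w : ℂ) * z‖ = ‖1 - conj (z : ℂ) * w‖ := by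
        rw [← RCLike.norm_conj (1 - conj (w : ℂ) * z)]
        simp [mul_comm]
      rw [h3]
      exact one_sub_norm_le_norm_one_sub_conj_mul z w
    rw [norm_div, norm_one, norm_pow]
    have : 0 < 1 - ‖(w : ℂ)‖ := by linarith
    gcongr

variable {φ}

/-- The reproducing formula for `k`, conjugated, is the kernel identity tested on the Bergman kernel
function at `w`. Hence a functional determines its kernel pointwise. -/
theorem IsKernel.apply_eq (hpq : p.HolderConjugate q) {k : BergmanSpace q} (hk : IsKernel φ k)
    (w : Disc) : k w = conj (φ (bergmanKernel p w)) := by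
  rw [hk, ← integral_conj, ← congrFun (k.bergmanProjection_eq hpq.symm.lt) w, bergmanProjection]
  refine integral_congr_ae (Eventually.of_forall fun z => ?_)
  have : bergmanKernel p w z = 1 / (1 - conj (w : ℂ) * z) ^ 2 := rfl
  simp only [this]
  simp [mul_comm, div_eq_mul_inv]

/-- Every bounded linear functional on `A ^ p` has exactly one kernel in `A ^ q`. -/
theorem existsUnique_isKernel (hpq : p.HolderConjugate q) (φ : StrongDual ℂ (BergmanSpace p)) :
    ∃! k : BergmanSpace q, IsKernel φ k :=
  ⟨_, isKernel_kernelSeries φ hpq, fun _ hk => BergmanSpace.ext fun z => by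
    rw [hk.apply_eq hpq, (isKernel_kernelSeries φ hpq).apply_eq hpq]⟩

end

/-! ### Minimal norm in a coset as an orthogonality condition -/

theorem norm_mul_dual_norm_eq {p q : ℝ} (hpq : p.HolderConjugate q) {a : ℝ} (ha : 0 ≤ a) :
    a * (a ^ p) ^ (1 / q) = a ^ p := by
  rw [← Real.rpow_mul ha, mul_one_div, hpq.div_conj_eq_sub_one]
  rcases ha.eq_or_lt with rfl | ha
  · rw [zero_mul, Real.zero_rpow hpq.pos.ne']
  · rw [Real.rpow_sub_one ha.ne', mul_div_cancel₀ _ ha.ne']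

/-- For `0 ≤ t ≤ 1` the integrand is dominated by `|h| (|F| + |h|)^(p-1)`, integrable by Hölder. -/
theorem tendsto_integral_mul_conj_powSgn {p q : ℝ} (hpq : p.HolderConjugate q) (F h : BergmanSpace p)
    {t : ℕ → ℝ} (ht : Tendsto t atTop (𝓝 0)) (ht0 : ∀ n, 0 ≤ t n) (ht1 : ∀ n, t n ≤ 1) :
    Tendsto (fun n => ∫ z, h z *
        conj (powSgn p ((F + (t n : ℂ) • h : BergmanSpace p) z)) ∂discMeasure) atTop
      (𝓝 (∫ z, h z * conj (powSgn p (F z)) ∂discMeasure)) := by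
  have hS : MemLp (fun z => ((‖F z‖ + ‖h z‖ : ℝ) : ℂ)) (ENNReal.ofReal p) discMeasure :=
    (F.memLp.norm.add h.memLp.norm).ofReal
  refine tendsto_integral_of_dominated_convergence _ (fun n => ?_)
    (integrable_mul_conj hpq h.memLp (hS.powSgn hpq)).norm (fun n => ?_) ?_
  · exact (integrable_mul_conj hpq h.memLp ((F + (t n : ℂ) • h).memLp.powSgn hpq)).1
  · refine Eventually.of_forall fun z => ?_
    have hle : ‖(F + (t n : ℂ) • h : BergmanSpace p) z‖ ≤ ‖F z‖ + ‖h z‖ := by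
      refine (norm_add_le (F z) ((t n : ℂ) • h z)).trans ?_
      rw [norm_smul, Complex.norm_real, Real.norm_of_nonneg (ht0 n)]
      gcongr
      exact mul_le_of_le_one_left (norm_nonneg _) (ht1 n)
    rw [norm_mul, norm_mul, RCLike.norm_conj, RCLike.norm_conj, norm_powSgn hpq.lt,
      norm_powSgn hpq.lt, Complex.norm_real, Real.norm_of_nonneg (by positivity)]
    have := sub_pos.2 hpq.lt
    gcongr
  · refine Eventually.of_forall fun z => ?_
    have h1 : Tendsto (fun n => F z + (t n : ℂ) • h z) atTop (𝓝 (F z)) := by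
      have h2 : Tendsto (fun n => (t n : ℂ)) atTop (𝓝 ((0 : ℝ) : ℂ)) :=
        (Complex.continuous_ofReal.tendsto 0).comp ht
      simpa using tendsto_const_nhds.add (h2.smul_const (h z))
    have hc : Continuous fun w : ℂ => h z * conj (powSgn p w) :=
      continuous_const.mul (Complex.continuous_conj.comp (continuous_powSgn hpq.lt))
    exact (hc.tendsto (F z)).comp h1

section

variable {p q : ℝ} [hp : Fact (1 < p)]

/-- The functional `f ↦ ∫ f conj(g) dσ` on `A ^ p` for `g` in `L ^ q`. -/
noncomputable def pairingFunctional (hpq : p.HolderConjugate q) (g : Disc → ℂ)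
    (hg : MemLp g (ENNReal.ofReal q) discMeasure) : StrongDual ℂ (BergmanSpace p) :=
  LinearMap.mkContinuous
    { toFun := fun f => ∫ z, f z * conj (g z) ∂discMeasure
      map_add' := fun f₁ f₂ => by
        rw [← integral_add (integrable_mul_conj hpq f₁.memLp hg)
          (integrable_mul_conj hpq f₂.memLp hg)]
        exact integral_congr_ae (Eventually.of_forall fun z => add_mul _ _ _)
      map_smul' := fun c f => by
        rw [RingHom.id_apply, smul_eq_mul, ← integral_const_mul]
        exact integral_congr_ae (Eventually.of_forall fun z => mul_assoc _ _ _) }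
    ((∫ z, ‖g z‖ ^ q ∂discMeasure) ^ (1 / q)) fun f => by
      rw [mul_comm, BergmanSpace.norm_eq]
      exact norm_integral_mul_conj_le hpq f.memLp hg

theorem pairingFunctional_apply (hpq : p.HolderConjugate q) {g : Disc → ℂ}
    (hg : MemLp g (ENNReal.ofReal q) discMeasure) (f : BergmanSpace p) :
    pairingFunctional hpq g hg f = ∫ z, f z * conj (g z) ∂discMeasure := rfl

/-- `∫ f conj(g) = ∫ (P f) conj(g) = ∫ f conj(P g)`, since `P` fixes `f` and is self-adjoint. -/
theorem isKernel_pairingFunctional (hpq : p.HolderConjugate q) {g : Disc → ℂ}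
    (hg : MemLp g (ENNReal.ofReal q) discMeasure) :
    IsKernel (pairingFunctional hpq g hg) (bergmanProj hpq.symm g hg) := by
  intro f
  have h := integral_bergmanProjection_mul_conj hpq f.memLp hg
  rw [f.bergmanProjection_eq hpq.lt] at h
  exact h

theorem norm_integral_mul_conj_powSgn_le (hpq : p.HolderConjugate q) (f G : BergmanSpace p) :
    ‖∫ z, f z * conj (powSgn p (G z)) ∂discMeasure‖ ≤ ‖f‖ * (‖G‖ ^ p) ^ (1 / q) := by
  have h := norm_integral_mul_conj_le hpq f.memLp (G.memLp.powSgn hpq)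
  simp only [norm_powSgn_rpow hpq] at h
  rwa [← BergmanSpace.norm_eq, ← BergmanSpace.norm_rpow_eq] at h

/-- Orthogonality and Hölder give `‖F‖^p = ∫ (F + h) conj(|F|^(p-1) sgn F) ≤ ‖F + h‖ ‖F‖^(p-1)`. -/
theorem norm_le_norm_add_of_integral_eq_zero (hpq : p.HolderConjugate q) {F h : BergmanSpace p}
    (hh : ∫ z, h z * conj (powSgn p (F z)) ∂discMeasure = 0) : ‖F‖ ≤ ‖F + h‖ := by
  have hFF := integral_mul_conj_powSgn (μ := discMeasure) hpq.lt (F : Disc → ℂ)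
  rw [← BergmanSpace.norm_rpow_eq] at hFF
  have h1 : ∫ z, (F + h : BergmanSpace p) z * conj (powSgn p (F z)) ∂discMeasure =
      ((‖F‖ ^ p : ℝ) : ℂ) := by
    have := map_add (pairingFunctional hpq _ (F.memLp.powSgn hpq)) F h
    simp only [pairingFunctional_apply] at this
    rw [this, hh, add_zero, hFF]
  have h2 := norm_integral_mul_conj_powSgn_le hpq (F + h) F
  rw [h1, Complex.norm_real, Real.norm_of_nonneg (by positivity)] at h2
  replace h2 := (norm_mul_dual_norm_eq hpq (norm_nonneg F)).trans_le h2
  rcases (norm_nonneg F).eq_or_lt with h0 | h0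
  · rw [← h0]; exact norm_nonneg _
  · exact le_of_mul_le_mul_right h2 (by positivity)

/-- With `G = F + t h`, pair `G` with its own norming functional: the part from `F` has real part at
most `‖F‖ ‖G‖^(p-1) ≤ ‖G‖^p`, so the part from `t h` is nonnegative. Using the functional of `G`,
not of `F`, avoids differentiating the norm. -/
theorem re_integral_mul_conj_powSgn_nonneg (hpq : p.HolderConjugate q) {F h : BergmanSpace p}
    {t : ℝ} (ht : 0 < t) (hF : ‖F‖ ≤ ‖F + (t : ℂ) • h‖) :
    0 ≤ (∫ z, h z * conj (powSgn p ((F + (t : ℂ) • h : BergmanSpace p) z)) ∂discMeasure).re := by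
  set G := F + (t : ℂ) • h with hG
  have hGG := integral_mul_conj_powSgn (μ := discMeasure) hpq.lt (G : Disc → ℂ)
  rw [← BergmanSpace.norm_rpow_eq] at hGG
  have h1 : ((‖G‖ ^ p : ℝ) : ℂ) = ∫ z, F z * conj (powSgn p (G z)) ∂discMeasure +
      t * ∫ z, h z * conj (powSgn p (G z)) ∂discMeasure := by
    rw [← hGG]
    have := map_add (pairingFunctional hpq _ (G.memLp.powSgn hpq)) F ((t : ℂ) • h)
    rwa [map_smul, ← hG] at this
  have h2 : (∫ z, F z * conj (powSgn p (G z)) ∂discMeasure).re ≤ ‖G‖ ^ p :=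
    calc _ ≤ ‖F‖ * (‖G‖ ^ p) ^ (1 / q) :=
          (Complex.re_le_norm _).trans (norm_integral_mul_conj_powSgn_le hpq F G)
      _ ≤ ‖G‖ * (‖G‖ ^ p) ^ (1 / q) := by gcongr
      _ = _ := norm_mul_dual_norm_eq hpq (norm_nonneg G)
  have h3 := congrArg Complex.re h1
  rw [Complex.ofReal_re, Complex.add_re, Complex.re_ofReal_mul] at h3
  exact nonneg_of_mul_nonneg_right (by linarith) ht

/-- An element of `A ^ p` has minimal norm in its coset of a subspace if and only if
`|F| ^ (p - 1) sgn F` is orthogonal to the subspace. -/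
theorem forall_norm_le_norm_add_iff (hpq : p.HolderConjugate q) (M : Submodule ℂ (BergmanSpace p))
    (F : BergmanSpace p) :
    (∀ h ∈ M, ‖F‖ ≤ ‖F + h‖) ↔
      ∀ h ∈ M, ∫ z, h z * conj (powSgn p (F z)) ∂discMeasure = 0 := by
  refine ⟨fun H h hh => ?_, fun H h hh => norm_le_norm_add_of_integral_eq_zero hpq (H h hh)⟩
  have hre : ∀ h ∈ M, 0 ≤ (∫ z, h z * conj (powSgn p (F z)) ∂discMeasure).re := by
    intro h hh
    have hlim := tendsto_integral_mul_conj_powSgn hpq F h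
      (tendsto_one_div_add_atTop_nhds_zero_nat (𝕜 := ℝ)) (fun n => by positivity)
      (fun n => (div_le_one (by positivity)).2 (by linarith [n.cast_nonneg (α := ℝ)]))
    refine ge_of_tendsto' ((Complex.continuous_re.tendsto _).comp hlim) fun n => ?_
    exact re_integral_mul_conj_powSgn_nonneg hpq (by positivity) (H _ (M.smul_mem _ hh))
  set a := ∫ z, h z * conj (powSgn p (F z)) ∂discMeasure with ha
  -- For this multiple of `h` the pairing equals `-|a|^2`, and nonnegativity forces `a = 0`.
  have h1 := hre (-conj a • h) (M.smul_mem _ hh)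
  have h2 := map_smul (pairingFunctional hpq _ (F.memLp.powSgn hpq)) (-conj a) h
  simp only [pairingFunctional_apply] at h2
  rw [h2, ← ha, smul_eq_mul, neg_mul, mul_comm, Complex.mul_conj, Complex.neg_re,
    Complex.ofReal_re, Complex.normSq_eq_norm_sq] at h1
  exact norm_eq_zero.1 (pow_eq_zero_iff two_ne_zero |>.1 (by nlinarith [sq_nonneg ‖a‖]))

/-! ### The interpolation problem and linear combinations of kernels -/

theorem norm_eq_sInf_iff {ι : Type*} (φ : ι → StrongDual ℂ (BergmanSpace p))
    (F : BergmanSpace p) :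
    ‖F‖ = sInf {r : ℝ | ∃ f : BergmanSpace p, (∀ j, φ j f = φ j F) ∧ r = ‖f‖} ↔
      ∀ h ∈ ⨅ j, LinearMap.ker (φ j : BergmanSpace p →ₗ[ℂ] ℂ), ‖F‖ ≤ ‖F + h‖ := by
  have hF : ‖F‖ ∈ {r : ℝ | ∃ f : BergmanSpace p, (∀ j, φ j f = φ j F) ∧ r = ‖f‖} :=
    ⟨F, fun _ => rfl, rfl⟩
  have hbdd : BddBelow {r : ℝ | ∃ f : BergmanSpace p, (∀ j, φ j f = φ j F) ∧ r = ‖f‖} :=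
    ⟨0, by rintro r ⟨f, -, rfl⟩; exact norm_nonneg f⟩
  constructor
  · intro H h hh
    rw [H]
    refine csInf_le hbdd ⟨F + h, fun j => ?_, rfl⟩
    have : φ j h = 0 := LinearMap.mem_ker.1 ((Submodule.mem_iInf _).1 hh j)
    rw [map_add, this, add_zero]
  · intro H
    refine le_antisymm (le_csInf ⟨_, hF⟩ ?_) (csInf_le hbdd hF)
    rintro r ⟨f, hf, rfl⟩
    have := H (f - F) ((Submodule.mem_iInf _).2 fun j => LinearMap.mem_ker.2 (by
      rw [ContinuousLinearMap.coe_coe, map_sub, hf, sub_self]))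
    rwa [add_sub_cancel] at this

/-- The kernel of a functional is a linear combination of given kernels if and only if the
functional vanishes on the common null space of the corresponding functionals. -/
theorem IsKernel.exists_eq_sum_iff (hpq : p.HolderConjugate q) {ι : Type*} [Fintype ι]
    {φ : ι → StrongDual ℂ (BergmanSpace p)} {k : ι → BergmanSpace q}
    (hk : ∀ j, IsKernel (φ j) (k j)) {ψ : StrongDual ℂ (BergmanSpace p)} {l : BergmanSpace q}
    (hl : IsKernel ψ l) :
    (∃ c : ι → ℂ, ∀ z, l z = ∑ j, c j * k j z) ↔
      ∀ h ∈ ⨅ j, LinearMap.ker (φ j : BergmanSpace p →ₗ[ℂ] ℂ), ψ h = 0 := by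
  constructor
  · rintro ⟨c, hc⟩ h hh
    have e : ∀ z, h z * conj (l z) = ∑ j, conj (c j) * (h z * conj (k j z)) := by
      intro z
      rw [hc, map_sum, Finset.mul_sum]
      refine Finset.sum_congr rfl fun j _ => ?_
      rw [map_mul]
      ring
    rw [hl h]
    simp only [e]
    rw [integral_finsetSum _ fun j _ =>
      (integrable_mul_conj hpq h.memLp (k j).memLp).const_mul _]
    refine Finset.sum_eq_zero fun j _ => ?_
    have : φ j h = 0 := LinearMap.mem_ker.1 ((Submodule.mem_iInf _).1 hh j)
    rw [integral_const_mul, ← hk j h, this, mul_zero]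
  · intro H
    have h1 := mem_span_of_iInf_ker_le_ker (L := fun j => (φ j : BergmanSpace p →ₗ[ℂ] ℂ))
      (K := (ψ : BergmanSpace p →ₗ[ℂ] ℂ)) fun h hh => LinearMap.mem_ker.2 (H h hh)
    obtain ⟨c, hc⟩ := (Submodule.mem_span_range_iff_exists_fun ℂ).1 h1
    -- The kernel depends conjugate-linearly on its functional. Evaluating the relation between
    -- functionals at the Bergman kernel function of `z` gives the relation between kernel values at
    -- `z`.
    refine ⟨fun j => conj (c j), fun z => ?_⟩
    have h2 := LinearMap.congr_fun hc (bergmanKernel p z)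
    rw [hl.apply_eq hpq, ← ContinuousLinearMap.coe_coe, ← h2, LinearMap.sum_apply, map_sum]
    refine Finset.sum_congr rfl fun j _ => ?_
    rw [(hk j).apply_eq hpq, LinearMap.smul_apply, smul_eq_mul, map_mul,
      ContinuousLinearMap.coe_coe]

end

theorem mainTheorem1 {p q : ℝ} [Fact (1 < p)] (hpq : p.HolderConjugate q) {N : ℕ}
    (φ : Fin N → StrongDual ℂ (BergmanSpace p)) (hφ : LinearIndependent ℂ φ) :
    (∀ j, ∃! k : BergmanSpace q, IsKernel (φ j) k) ∧
    ∀ k : Fin N → BergmanSpace q, (∀ j, IsKernel (φ j) (k j)) →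
      ∀ F : BergmanSpace p,
        ‖F‖ = sInf {r : ℝ | ∃ f : BergmanSpace p, (∀ j, φ j f = φ j F) ∧ r = ‖f‖} ↔
        ∃ c : Fin N → ℂ, ∀ z : Disc,
          bergmanProjection (fun ζ => ((‖F ζ‖ ^ (p - 1) : ℝ) : ℂ) * complexSgn (F ζ)) z =
            ∑ j, c j * k j z := by
  refine ⟨fun j => existsUnique_isKernel hpq (φ j), fun k hk F => ?_⟩
  rw [norm_eq_sInf_iff, forall_norm_le_norm_add_iff hpq]
  exact (IsKernel.exists_eq_sum_iff hpq hk
    (isKernel_pairingFunctional hpq (F.memLp.powSgn hpq))).symm
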